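/- Let $d\ge 1$ and write $V$ for $d$-dimensional Lebesgue measure. For a polytope $P\subset\mathbb{R}^d$ (the convex hull of finitely many points) with $V(P)=1$ and for $z\in P$ let $$v(z)=\min\{V(P\cap H): H \text{ a closed half-space with } z\in H\},\qquad P(v\ge T)=\{y\in P: v(y)\ge T\},$$ and let $$S(z,T)=\{x\in P: [x,z]\cap P(v\ge T)=\varnothing\}$$ be the set of points visible from $z$ within $P(v<T)$, where $[x,z]$ is the closed segment joining $x$ and $z$. Let $F(P)$ be the number of flags of $P$, that is, of sequences $F_0\subset F_1\subset\dots\subset F_{d-1}$ of faces of $P$ with $\dim F_i=i$. There is a constant $c>0$ depending only on $d$ such that for every polytope $P\subset\mathbb{R}^d$ of volume $1$, every $z\in P$ and every real $T$ with $0<v(z)\le\frac12$ and $2v(z)\le T$, $$V(S(z,T))< c\,F(P)\,T\,\ln^{d-1}\!\Bigl(\frac{T}{v(z)}\Bigr).$$ -/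

import Mathlib

open MeasureTheory Set

noncomputable section

namespace PoissonPolytope

/-- Euclidean `d`-space. -/
abbrev Euc (d : ℕ) : Type := EuclideanSpace ℝ (Fin d)

/-- A convex polytope: the convex hull of finitely many points. -/
def IsPolytope {d : ℕ} (P : Set (Euc d)) : Prop :=
  ∃ V : Finset (Euc d), P = convexHull ℝ (V : Set (Euc d))

/-- A closed half-space: `{x | u · x ≥ t}` for a nonzero normal vector `u` and a real `t`. -/
def IsHalfSpace {d : ℕ} (H : Set (Euc d)) : Prop :=
  ∃ (u : Euc d) (t : ℝ), u ≠ 0 ∧ H = {x | t ≤ inner ℝ u x}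

/-- `v(z)`: the smallest volume cut off from `K` by a half-space that contains `z`.
For compact `K` (and `d ≥ 1`) the infimum is a minimum. -/
def capVol {d : ℕ} (K : Set (Euc d)) (z : Euc d) : ℝ :=
  sInf {a | ∃ H : Set (Euc d), IsHalfSpace H ∧ z ∈ H ∧ a = volume.real (K ∩ H)}

/-- The floating body `K(v ≥ t)`. -/
def floatingBody {d : ℕ} (K : Set (Euc d)) (t : ℝ) : Set (Euc d) :=
  {z | z ∈ K ∧ t ≤ capVol K z}

/-- `S(z, T)`: the points of `K` visible from `z` within `K(v < T)`, i.e. those `x ∈ K` for which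
the closed segment `[x, z]` misses `K(v ≥ T)`. -/
def visibleSet {d : ℕ} (K : Set (Euc d)) (z : Euc d) (T : ℝ) : Set (Euc d) :=
  {x | x ∈ K ∧ segment ℝ x z ∩ floatingBody K T = ∅}

/-- A nonempty face of `P` of dimension `k`: a nonempty set of all maximizers over `P` of some
linear functional, whose affine hull has dimension `k`. -/
def IsFaceOfDim {d : ℕ} (P : Set (Euc d)) (k : ℕ) (F : Set (Euc d)) : Prop :=
  F.Nonempty ∧ IsExposed ℝ P F ∧ Module.finrank ℝ (vectorSpan ℝ F) = k

/-- A flag of `P`: faces `F₀ ⊆ F₁ ⊆ ⋯ ⊆ F_{d-1}` of `P` with `dim Fᵢ = i`. -/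
def IsFlag {d : ℕ} (P : Set (Euc d)) (F : Fin d → Set (Euc d)) : Prop :=
  (∀ i : Fin d, IsFaceOfDim P i (F i)) ∧ ∀ i j : Fin d, i ≤ j → F i ⊆ F j

/-- `F(P)`, the number of flags of `P` (a polytope has finitely many faces, hence flags). -/
def numFlags {d : ℕ} (P : Set (Euc d)) : ℕ :=
  {F : Fin d → Set (Euc d) | IsFlag P F}.ncard

end PoissonPolytope

end

noncomputable section

namespace PoissonPolytope

/-! If `x` is visible from `z`, the midpoint `m` of `[x, z]` has `v(m) < T`, so it suffices to bound
the volume of all such `x`. Choosing a central point `c F` in every face covers `P` by one simplex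
per flag, with vertices `c (F_0), ..., c (F_{d-1}), c P` (`exists_chain`). Centrality
(`exists_central_point`) lets every edge leaving `c (F_0)` be prolonged by the factor `1 + 1/d`
inside `P`. Cap volumes scale by the determinant under linear maps (`capVol_image`), so the edges of
a nondegenerate simplex may be taken to be the standard basis `e_i`, and `x = c + l` with
coordinates `l_i ≥ 0`.

Two motions are now available inside the body. Near `x` there is room of order `l_i` in each
direction `e_i`. Near `z` there is room for a lower triangular frame `p` of the Macbeath region
whose diagonal product is at least a constant times `v(z)` (`mem_triSet_of_lt_capVol`). Averaging
them puts a parallelepiped around `m` with edges proportional to `l_i e_i + p_i`. This frame is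
again triangular, so its determinant is a product of sums and `∏ (l_i + p_ii)` is at most a constant
times `v(m) < T` (`le_capVol_midpoint`).

The set of such `l` is a hyperbolic region of volume at most a constant times `T ln^{d-1}(T / v(z))`
(`volume_prod_add_lt_le`). Summing over the flags gives the factor `F(P)`. -/

/-! ### Volumes of hyperbolic regions. -/

/-- Fixing the first coordinate `x` leaves the same region with `R / x` in place of `R`, so Fubini
gives an induction on the number of coordinates. -/
theorem volume_one_le_prod_lt_le (n : ℕ) (R : ℝ) (hR : 1 ≤ R) :
    volume {u : Fin (n + 1) → ℝ | (∀ i, 1 ≤ u i) ∧ ∏ i, u i < R} ≤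
      ENNReal.ofReal (R * Real.log R ^ n) := by
  induction n generalizing R with
  | zero =>
    have h := (volume_preserving_funUnique (Fin 1) ℝ).measure_preimage
      (s := Ico 1 R) measurableSet_Ico.nullMeasurableSet
    have hs : {u : Fin (0 + 1) → ℝ | (∀ i, 1 ≤ u i) ∧ ∏ i, u i < R} =
        MeasurableEquiv.funUnique (Fin 1) ℝ ⁻¹' Ico 1 R := by
      ext u; simp
    rw [hs]
    refine (le_of_eq h).trans ?_
    rw [Real.volume_Ico]
    exact ENNReal.ofReal_le_ofReal (by simp)
  | succ n ih =>
    have hlog : 0 ≤ Real.log R := Real.log_nonneg hR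
    set U : Set (ℝ × (Fin (n + 1) → ℝ)) :=
      {q | 1 ≤ q.1 ∧ (∀ i, 1 ≤ q.2 i) ∧ q.1 * ∏ i, q.2 i < R} with hU
    have hUm : MeasurableSet U := by
      have e : U = {q | 1 ≤ q.1} ∩ ((⋂ i, {q | 1 ≤ q.2 i}) ∩ {q | q.1 * ∏ i, q.2 i < R}) := by
        ext q; simp [hU]
      rw [e]
      refine (measurableSet_le (by fun_prop) (by fun_prop)).inter
        ((MeasurableSet.iInter fun i => measurableSet_le (by fun_prop) (by fun_prop)).inter
          (measurableSet_lt (by fun_prop) (by fun_prop)))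
    have h := (volume_preserving_piFinSuccAbove (fun _ : Fin (n + 2) => ℝ) 0).measure_preimage
      hUm.nullMeasurableSet
    have hs : {u : Fin (n + 1 + 1) → ℝ | (∀ i, 1 ≤ u i) ∧ ∏ i, u i < R} =
        MeasurableEquiv.piFinSuccAbove (fun _ : Fin (n + 2) => ℝ) 0 ⁻¹' U := by
      ext u
      simp [hU, Fin.forall_fin_succ (n := n + 1), Fin.prod_univ_succ (n := n + 1), and_assoc,
        Fin.tail]
    rw [hs, h, Measure.volume_eq_prod, Measure.prod_apply hUm]
    -- Bounding `log (R / x)` by `log R` leaves only `1 / x` to integrate over `[1, R]`, which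
    -- yields one more factor `log R`.
    have key : ∀ x : ℝ, volume (Prod.mk x ⁻¹' U) ≤
        (Icc 1 R).indicator (fun x => ENNReal.ofReal (R * Real.log R ^ n * x⁻¹)) x := by
      intro x
      by_cases hx : x ∈ Icc 1 R
      · rw [indicator_of_mem hx]
        have hx0 : 0 < x := by linarith [hx.1]
        have hs : Prod.mk x ⁻¹' U ⊆ {u : Fin (n + 1) → ℝ | (∀ i, 1 ≤ u i) ∧ ∏ i, u i < R / x} := by
          rintro v ⟨-, h2, h3⟩
          exact ⟨h2, by rw [lt_div_iff₀ hx0, mul_comm]; exact h3⟩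
        have h1 : 1 ≤ R / x := by rw [le_div_iff₀ hx0]; linarith [hx.2]
        refine (measure_mono hs).trans ((ih _ h1).trans (ENNReal.ofReal_le_ofReal ?_))
        have h2 : Real.log (R / x) ≤ Real.log R :=
          Real.log_le_log (by positivity) (div_le_self (by linarith) hx.1)
        have h3 : Real.log (R / x) ^ n ≤ Real.log R ^ n :=
          pow_le_pow_left₀ (Real.log_nonneg h1) h2 n
        calc R / x * Real.log (R / x) ^ n ≤ R / x * Real.log R ^ n := by
              gcongr
          _ = _ := by field_simp
      · rw [indicator_of_notMem hx]
        have : Prod.mk x ⁻¹' U = ∅ := by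
          refine eq_empty_of_forall_notMem ?_
          rintro v ⟨h1, h2, h3⟩
          refine hx ⟨h1, ?_⟩
          have : 1 ≤ ∏ i, v i := by
            simpa using Finset.prod_le_prod (s := Finset.univ) (f := fun _ => (1 : ℝ))
              (fun i _ => zero_le_one) (fun i _ => h2 i)
          simp only at h1 h3
          nlinarith
        rw [this, measure_empty]
    refine (lintegral_mono key).trans ?_
    rw [lintegral_indicator measurableSet_Icc]
    have hint : IntegrableOn (fun x : ℝ => R * Real.log R ^ n * x⁻¹) (Icc 1 R) := by
      refine ContinuousOn.integrableOn_compact isCompact_Icc ?_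
      refine continuousOn_const.mul (continuousOn_inv₀.mono ?_)
      intro x hx
      have := hx.1
      simp only [mem_compl_iff, mem_singleton_iff]
      linarith
    rw [← ofReal_integral_eq_lintegral_ofReal hint]
    · refine ENNReal.ofReal_le_ofReal (le_of_eq ?_)
      rw [integral_Icc_eq_integral_Ioc, ← intervalIntegral.integral_of_le hR,
        intervalIntegral.integral_const_mul, integral_inv_of_pos one_pos (by linarith)]
      rw [div_one, pow_succ]; ring
    · refine (ae_restrict_iff' measurableSet_Icc).2 (ae_of_all _ fun x hx => ?_)
      have := hx.1
      simp only [Pi.zero_apply]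
      positivity

/-- The substitution `u_i = (x_i + μ_i) / μ_i` reduces this to the previous region; its Jacobian
cancels the denominator of `N / ∏ μ_i` outside the logarithm. -/
theorem volume_prod_add_lt_le {n : ℕ} (μ : Fin (n + 1) → ℝ) (hμ : ∀ i, 0 < μ i) (N : ℝ)
    (hN : ∏ i, μ i ≤ N) :
    volume {x : Euc (n + 1) | (∀ i, 0 ≤ x i) ∧ ∏ i, (x i + μ i) < N} ≤
      ENNReal.ofReal (N * Real.log (N / ∏ i, μ i) ^ n) := by
  have hp : 0 < ∏ i, μ i := Finset.prod_pos fun i _ => hμ i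
  set U := {u : Fin (n + 1) → ℝ | (∀ i, 1 ≤ u i) ∧ ∏ i, u i < N / ∏ i, μ i} with hU
  have hUm : MeasurableSet U := by
    have e : U = (⋂ i, {u | 1 ≤ u i}) ∩ {u | ∏ i, u i < N / ∏ i, μ i} := by
      ext q; simp [hU]
    rw [e]
    exact (MeasurableSet.iInter fun i => measurableSet_le (by fun_prop) (by fun_prop)).inter
          (measurableSet_lt (by fun_prop) (by fun_prop))
  set L := Matrix.toLin' (Matrix.diagonal fun i => (μ i)⁻¹) with hL
  have hdet : LinearMap.det L = (∏ i, μ i)⁻¹ := by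
    rw [hL, LinearMap.det_toLin', Matrix.det_diagonal, Finset.prod_inv_distrib]
  have hLa : ∀ x i, L x i = (μ i)⁻¹ * x i := by
    intro x i
    rw [hL, Matrix.toLin'_apply, Matrix.mulVec_diagonal]
  have hs : {x : Euc (n + 1) | (∀ i, 0 ≤ x i) ∧ ∏ i, (x i + μ i) < N} =
      (@WithLp.ofLp 2 (Fin (n + 1) → ℝ)) ⁻¹' ((fun x => x + μ) ⁻¹' (L ⁻¹' U)) := by
    ext x
    simp only [hU, mem_ofPred_eq, mem_preimage, hLa, Pi.add_apply, Finset.prod_mul_distrib,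
      Finset.prod_inv_distrib]
    refine and_congr (forall_congr' fun i => ?_) ?_
    · rw [inv_mul_eq_div, le_div_iff₀ (hμ i)]
      constructor <;> intro h <;> linarith
    · rw [inv_mul_eq_div, div_lt_div_iff_of_pos_right hp]
  have hLm : MeasurableSet (L ⁻¹' U) := by
    refine hUm.preimage ?_
    exact (LinearMap.continuous_of_finiteDimensional L).measurable
  rw [hs, (PiLp.volume_preserving_ofLp (Fin (n + 1))).measure_preimage
    ((hLm.preimage (measurable_add_const μ)).nullMeasurableSet), measure_preimage_add_right,
    Measure.addHaar_preimage_linearMap _ (by rw [hdet]; positivity), hdet, inv_inv,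
    abs_of_pos hp]
  refine (mul_le_mul_right (volume_one_le_prod_lt_le n _ ((one_le_div hp).2 hN)) _).trans ?_
  rw [← ENNReal.ofReal_mul hp.le, ← mul_assoc, mul_div_cancel₀ _ hp.ne']


/-! ### Triangular frames, symmetric bodies and cap volumes. -/

/-- The Macbeath region of `K` at `y`, centred at the origin. -/
def macbeath {d : ℕ} (K : Set (Euc d)) (y : Euc d) : Set (Euc d) := {p | y + p ∈ K ∧ y - p ∈ K}

/-- The family `p` is lower triangular with nonnegative diagonal. -/
def IsTri {d : ℕ} (p : Fin d → Euc d) : Prop := (∀ i j, i < j → p j i = 0) ∧ ∀ j, 0 ≤ p j j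

/-- The linear map sending the standard basis to `p`. -/
def frameMap {d : ℕ} (p : Fin d → Euc d) : Euc d →ₗ[ℝ] Euc d :=
  (EuclideanSpace.basisFun (Fin d) ℝ).toBasis.constr ℝ p

theorem frameMap_apply {d : ℕ} (p : Fin d → Euc d) (x : Euc d) :
    frameMap p x = ∑ i, x i • p i := by
  simp [frameMap, Module.Basis.constr_apply_fintype]

theorem IsTri.det_frameMap {d : ℕ} {p : Fin d → Euc d} (hp : ∀ i j, i < j → p j i = 0) :
    LinearMap.det (frameMap p) = ∏ i, p i i := by
  rw [← LinearMap.det_toMatrix (EuclideanSpace.basisFun (Fin d) ℝ).toBasis,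
    Matrix.det_of_isLowerTriangular]
  · refine Finset.prod_congr rfl fun i _ => ?_
    simp [LinearMap.toMatrix_apply, frameMap_apply]
  · intro i j hij
    simpa [LinearMap.toMatrix_apply, frameMap_apply] using hp i j hij

theorem volume_box {d : ℕ} (r : Fin d → ℝ) (hr : ∀ i, 0 ≤ r i) :
    volume {x : Euc d | ∀ i, |x i| ≤ r i} = ENNReal.ofReal (2 ^ d * ∏ i, r i) := by
  have hs : {x : Euc d | ∀ i, |x i| ≤ r i} =
      (@WithLp.ofLp 2 (Fin d → ℝ)) ⁻¹' (Icc (fun i => -r i) r) := by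
    ext x
    simp only [mem_ofPred_eq, abs_le, mem_preimage, mem_Icc, Pi.le_def]
    exact forall_and
  rw [hs, (PiLp.volume_preserving_ofLp (Fin d)).measure_preimage
    measurableSet_Icc.nullMeasurableSet, Real.volume_Icc_pi, ← ENNReal.ofReal_prod_of_nonneg]
  · congr 1
    simp only [sub_neg_eq_add, ← two_mul, Finset.prod_mul_distrib]
    simp
  · intro i _
    linarith [hr i]

/-- The cube `[-1, 1] ^ d`. -/
def box {d : ℕ} : Set (Euc d) := {x | ∀ i, |x i| ≤ 1}

theorem volume_frameMap_image_box {d : ℕ} {q : Fin d → Euc d} (hq : IsTri q) :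
    volume (frameMap q '' box) = ENNReal.ofReal (2 ^ d * ∏ i, q i i) := by
  have hb : volume (box : Set (Euc d)) = ENNReal.ofReal (2 ^ d) := by
    simpa [box] using volume_box (fun _ : Fin d => (1 : ℝ)) (fun _ => zero_le_one)
  have h0 : 0 ≤ ∏ i, q i i := Finset.prod_nonneg fun i _ => hq.2 i
  rw [Measure.addHaar_image_linearMap, IsTri.det_frameMap hq.1, hb, abs_of_nonneg h0,
    ← ENNReal.ofReal_mul h0, mul_comm]

theorem capVol_set_nonempty {d : ℕ} (hd : 1 ≤ d) (K : Set (Euc d)) (z : Euc d) :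
    {a | ∃ H : Set (Euc d), IsHalfSpace H ∧ z ∈ H ∧ a = volume.real (K ∩ H)}.Nonempty := by
  have : Nonempty (Fin d) := ⟨⟨0, hd⟩⟩
  obtain ⟨u, hu⟩ := exists_ne (0 : Euc d)
  exact ⟨_, {x | inner ℝ u z ≤ inner ℝ u x}, ⟨u, _, hu, rfl⟩, by simp, rfl⟩

theorem capVol_le {d : ℕ} {K H : Set (Euc d)} {z : Euc d} (hH : IsHalfSpace H) (hz : z ∈ H) :
    capVol K z ≤ volume.real (K ∩ H) :=
  csInf_le ⟨0, by rintro _ ⟨H, -, -, rfl⟩; exact measureReal_nonneg⟩ ⟨H, hH, hz, rfl⟩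

/-- A half-space containing the centre of a symmetric set contains at least half of that set. -/
theorem le_capVol_of_symm {d : ℕ} (hd : 1 ≤ d) {K Q : Set (Euc d)} {m : Euc d}
    (hK : volume K ≠ ⊤) (hsymm : ∀ q ∈ Q, -q ∈ Q)
    (hQ : ∀ q ∈ Q, m + q ∈ K) {s : ℝ} (hs : ENNReal.ofReal s ≤ volume Q) : s / 2 ≤ capVol K m := by
  refine le_csInf (capVol_set_nonempty hd K m) ?_
  rintro _ ⟨_, ⟨u, t, hu, rfl⟩, hm, rfl⟩
  simp only [mem_ofPred_eq] at hm
  set R : Set (Euc d) := {q ∈ Q | 0 ≤ inner ℝ u q} with hR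
  have h1 : Q ⊆ R ∪ -R := by
    intro q hq
    rcases le_total 0 (inner ℝ u q) with h | h
    · exact Or.inl ⟨hq, h⟩
    · exact Or.inr ⟨hsymm q hq, by simpa using h⟩
  have h2 : volume R ≤ volume (K ∩ {x | t ≤ inner ℝ u x}) := by
    have h3 : (fun q => m + q) '' R ⊆ K ∩ {x | t ≤ inner ℝ u x} := by
      rintro _ ⟨q, ⟨hq, hq'⟩, rfl⟩
      refine ⟨hQ q hq, ?_⟩
      simp only [mem_ofPred_eq, inner_add_right]
      linarith
    calc volume R = volume ((fun q => m + q) '' R) := by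
          rw [image_add_left, measure_preimage_add]
      _ ≤ _ := measure_mono h3
  have h4 : ENNReal.ofReal s ≤ 2 * volume (K ∩ {x | t ≤ inner ℝ u x}) := by
    calc ENNReal.ofReal s ≤ volume (R ∪ -R) := hs.trans (measure_mono h1)
      _ ≤ volume R + volume (-R) := measure_union_le _ _
      _ = 2 * volume R := by rw [Measure.measure_neg, two_mul]
      _ ≤ _ := by gcongr
  have hfin : volume (K ∩ {x | t ≤ inner ℝ u x}) ≠ ⊤ := measure_ne_top_of_subset inter_subset_left hK
  have h5 := (ENNReal.ofReal_le_iff_le_toReal (ENNReal.mul_ne_top (by simp) hfin)).1 h4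
  rw [ENNReal.toReal_mul] at h5
  simp only [ENNReal.toReal_ofNat] at h5
  change s / 2 ≤ (volume (K ∩ {x | t ≤ inner ℝ u x})).toReal
  linarith

theorem le_capVol_of_tri {d : ℕ} (hd : 1 ≤ d) {K : Set (Euc d)} {m : Euc d}
    (hK : volume K ≠ ⊤) {q : Fin d → Euc d} (hq : IsTri q)
    (hQ : ∀ s : Euc d, (∀ i, |s i| ≤ 1) → m + ∑ i, s i • q i ∈ K) :
    2 ^ d * (∏ i, q i i) / 2 ≤ capVol K m := by
  refine le_capVol_of_symm (Q := frameMap q '' box) hd hK ?_ ?_ (volume_frameMap_image_box hq).ge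
  · rintro _ ⟨s, hs, rfl⟩
    exact ⟨-s, fun i => by simpa using hs i, by simp⟩
  · rintro _ ⟨s, hs, rfl⟩
    rw [frameMap_apply]
    exact hQ s hs

theorem convex_macbeath {d : ℕ} {K : Set (Euc d)} (hK : Convex ℝ K) (y : Euc d) :
    Convex ℝ (macbeath K y) := by
  intro p hp q hq a b ha hb hab
  constructor
  · have := hK hp.1 hq.1 ha hb hab
    convert! this using 1
    rw [smul_add, smul_add, add_add_add_comm, ← add_smul, hab, one_smul]
  · have := hK hp.2 hq.2 ha hb hab
    convert! this using 1
    rw [smul_sub, smul_sub, sub_add_sub_comm, ← add_smul, hab, one_smul]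

theorem isCompact_macbeath {d : ℕ} {K : Set (Euc d)} (hK : IsCompact K) (y : Euc d) :
    IsCompact (macbeath K y) := by
  have h : macbeath K y = (Homeomorph.addLeft y ⁻¹' K) ∩ (fun p => y - p) ⁻¹' K := rfl
  rw [h]
  exact ((Homeomorph.addLeft y).isCompact_preimage.2 hK).inter_right
    (hK.isClosed.preimage (by fun_prop))

theorem neg_mem_macbeath {d : ℕ} {K : Set (Euc d)} {y p : Euc d} (hp : p ∈ macbeath K y) :
    -p ∈ macbeath K y := ⟨by simpa [sub_eq_add_neg] using hp.2, by simpa using hp.1⟩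


theorem smul_mem_of_symm {d : ℕ} {M : Set (Euc d)} (hM : Convex ℝ M) (hs : ∀ p ∈ M, -p ∈ M)
    {p : Euc d} (hp : p ∈ M) {c : ℝ} (hc : |c| ≤ 1) : c • p ∈ M := by
  rw [abs_le] at hc
  have := hM hp (hs p hp) (a := (1 + c) / 2) (b := (1 - c) / 2) (by linarith) (by linarith)
    (by ring)
  convert! this using 1
  rw [smul_neg, ← sub_eq_add_neg, ← sub_smul]
  congr 1; ring

/-- `p j` maximizes the `j`-th coordinate over the points of `M` whose earlier coordinates vanish.
-/
theorem exists_greedy_tri {d : ℕ} {M : Set (Euc d)} (hM : IsCompact M) (h0 : 0 ∈ M) :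
    ∃ p : Fin d → Euc d, IsTri p ∧ (∀ j, p j ∈ M) ∧
      ∀ j, ∀ q ∈ M, (∀ i < j, q i = 0) → q j ≤ p j j := by
  have h : ∀ j : Fin d, ∃ p ∈ M ∩ {q : Euc d | ∀ i < j, q i = 0},
      IsMaxOn (fun q : Euc d => q j) (M ∩ {q : Euc d | ∀ i < j, q i = 0}) p := by
    intro j
    refine IsCompact.exists_isMaxOn (hM.inter_right ?_) ⟨0, h0, by simp⟩ (by fun_prop)
    have : {q : Euc d | ∀ i < j, q i = 0} = ⋂ i, ⋂ (_ : i < j), {q : Euc d | q i = 0} := by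
      ext q; simp
    rw [this]
    exact isClosed_iInter fun i => isClosed_iInter fun _ =>
      isClosed_eq (by fun_prop) (by fun_prop)
  choose p hp hmax using h
  refine ⟨p, ⟨fun i j hij => (hp j).2 i hij, fun j => ?_⟩, fun j => (hp j).1, fun j q hq hq' =>
    hmax j ⟨hq, hq'⟩⟩
  simpa using hmax j ⟨h0, by simp⟩

/-- Gaussian elimination along the greedy frame: the coordinates of a point of `M` are cleared one
by one, and maximality bounds each coefficient. Hence `M` lies in the image of a box under a
unipotent map. -/
theorem volume_le_of_greedy_tri {d : ℕ} {M : Set (Euc d)} (hM : Convex ℝ M)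
    (hs : ∀ p ∈ M, -p ∈ M) {p : Fin d → Euc d} (hp : IsTri p)
    (hpM : ∀ j, p j ∈ M) (hmax : ∀ j, ∀ q ∈ M, (∀ i < j, q i = 0) → q j ≤ p j j) :
    volume M ≤ ENNReal.ofReal (2 ^ d * ∏ j : Fin d, (2 ^ (j : ℕ) * p j j)) := by
  -- The default basis vector for `p j j = 0` keeps the determinant equal to 1; the coefficient of
  -- `r j` is then forced to be 0.
  set r : Fin d → Euc d := fun j =>
    if p j j = 0 then EuclideanSpace.single j 1 else (p j j)⁻¹ • p j with hr
  have hr0 : ∀ i j, i < j → r j i = 0 := by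
    intro i j hij
    by_cases h : p j j = 0
    · simp [hr, h, hij.ne]
    · simp [hr, h, hp.1 i j hij]
  have hr1 : ∀ j, r j j = 1 := by
    intro j
    by_cases h : p j j = 0 <;> simp [hr, h]
  have hdet : LinearMap.det (frameMap r) = 1 := by
    rw [IsTri.det_frameMap hr0]; simp [hr1]
  have hsub : M ⊆ frameMap r '' {x : Euc d | ∀ j, |x j| ≤ 2 ^ (j : ℕ) * p j j} := by
    intro q hq
    have h0 : (0 : Euc d) ∈ M := by
      simpa using smul_mem_of_symm hM hs hq (c := 0) (by simp)
    have key : ∀ k : ℕ, k ≤ d → ∃ a : Euc d, (∀ j, |a j| ≤ 2 ^ (j : ℕ) * p j j) ∧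
        (∀ j : Fin d, k ≤ j → a j = 0) ∧ ((2 : ℝ) ^ k)⁻¹ • (q - frameMap r a) ∈ M ∧
        ∀ j : Fin d, (j : ℕ) < k → (q - frameMap r a) j = 0 := by
      intro k
      induction k with
      | zero =>
        intro _
        refine ⟨0, fun j => ?_, by simp, by simpa using hq, by simp⟩
        have := hp.2 j
        simp only [PiLp.zero_apply, abs_zero]
        positivity
      | succ k ih =>
        intro hk
        obtain ⟨a, ha, ha0, haM, hac⟩ := ih (by omega)
        set j : Fin d := ⟨k, hk⟩ with hj
        set w := q - frameMap r a with hw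
        have hk0 : (0 : ℝ) < 2 ^ k := by positivity
        have hα : |w j| ≤ 2 ^ k * p j j := by
          have h1 := hmax j _ haM (fun i hi => by
            have := hac i (Fin.lt_def.1 hi)
            rw [PiLp.smul_apply, this, smul_zero])
          have h2 := hmax j _ (hs _ haM) (fun i hi => by
            have := hac i (Fin.lt_def.1 hi)
            rw [PiLp.neg_apply, PiLp.smul_apply, this, smul_zero, neg_zero])
          rw [PiLp.smul_apply, smul_eq_mul, inv_mul_eq_div, div_le_iff₀ hk0] at h1
          rw [PiLp.neg_apply, PiLp.smul_apply, smul_eq_mul, inv_mul_eq_div, ← neg_div,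
            div_le_iff₀ hk0] at h2
          rw [abs_le]
          constructor <;> linarith
        have hM2 : ((2 : ℝ) ^ k)⁻¹ • w j • r j ∈ M := by
          by_cases h : p j j = 0
          · have : w j = 0 := by
              rw [h, mul_zero] at hα
              exact abs_nonpos_iff.1 hα
            rw [this]; simpa using h0
          · have hpos : 0 < p j j := lt_of_le_of_ne (hp.2 j) (Ne.symm h)
            have : ((2 : ℝ) ^ k)⁻¹ • w j • r j = (w j / (2 ^ k * p j j)) • p j := by
              simp only [hr, h, if_false, smul_smul]
              congr 1
              field_simp
            rw [this]
            refine smul_mem_of_symm hM hs (hpM j) ?_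
            rw [abs_div, abs_of_pos (by positivity : 0 < 2 ^ k * p j j)]
            exact div_le_one_of_le₀ hα (by positivity)
        have hq' : q - frameMap r (a + w j • EuclideanSpace.single j 1) = w - w j • r j := by
          rw [map_add, map_smul, ← sub_sub, ← hw]
          congr 2
          simp [frameMap_apply]
        refine ⟨a + w j • EuclideanSpace.single j 1, fun i => ?_, fun i hi => ?_, ?_, ?_⟩
        · by_cases hij : i = j
          · subst hij
            simpa [ha0 j le_rfl] using hα
          · simpa [hij] using ha i
        · have hij : i ≠ j := by rintro rfl; simp [hj] at hi
          have := ha0 i (by omega)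
          simp [hij, this]
        · rw [hq']
          -- Subtraction within a symmetric convex set costs a factor 2; this is the origin of the
          -- powers `2 ^ j`.
          have := hM haM (hs _ hM2) (a := 1 / 2) (b := 1 / 2) (by norm_num) (by norm_num)
            (by norm_num)
          convert! this using 1
          rw [smul_neg, ← sub_eq_add_neg, ← smul_sub, ← smul_sub, smul_smul, pow_succ]
          congr 1
          rw [mul_inv]; ring
        · intro i hi
          rw [hq', PiLp.sub_apply, PiLp.smul_apply, smul_eq_mul]
          by_cases hij : i = j
          · subst hij; rw [hr1]; ring
          · have hik : (i : ℕ) < k := by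
              have : (i : ℕ) ≠ k := fun h => hij (Fin.ext h)
              omega
            rw [hac i hik, hr0 i j (Fin.lt_def.2 hik)]; ring
    obtain ⟨a, ha, -, -, hac⟩ := key d le_rfl
    refine ⟨a, ha, ?_⟩
    have : q - frameMap r a = 0 := by
      ext i; simpa using hac i i.2
    exact (sub_eq_zero.1 this).symm
  refine (measure_mono hsub).trans ?_
  rw [Measure.addHaar_image_linearMap, hdet, abs_one, ENNReal.ofReal_one, one_mul,
    volume_box _ fun j => by have := hp.2 j; positivity]

/-! ### Large cap volume forces a large triangular frame. -/

/-- The points of `K` that are centres of triangular cross-polytopes in `K` with diagonal product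
at least `s`. -/
def triSet {d : ℕ} (K : Set (Euc d)) (s : ℝ) : Set (Euc d) :=
  {y | ∃ p : Fin d → Euc d, IsTri p ∧ (∀ j, p j ∈ macbeath K y) ∧ s ≤ ∏ j, p j j}

theorem le_prod_convex_comb {ι : Type*} [Fintype ι] {f g : ι → ℝ} (hf : ∀ i, 0 ≤ f i)
    (hg : ∀ i, 0 ≤ g i) {s a b : ℝ} (hs : 0 < s) (hfs : s ≤ ∏ i, f i) (hgs : s ≤ ∏ i, g i)
    (ha : 0 ≤ a) (hb : 0 ≤ b) (hab : a + b = 1) : s ≤ ∏ i, (a * f i + b * g i) := by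
  calc s = s ^ a * s ^ b := by rw [← Real.rpow_add hs, hab, Real.rpow_one]
    _ ≤ (∏ i, f i) ^ a * (∏ i, g i) ^ b := by
      have := Finset.prod_nonneg fun i (_ : i ∈ Finset.univ) => hf i
      gcongr
    _ = ∏ i, (f i ^ a * g i ^ b) := by
      rw [Finset.prod_mul_distrib, Real.finsetProd_rpow _ _ fun i _ => hf i,
        Real.finsetProd_rpow _ _ fun i _ => hg i]
    _ ≤ _ := Finset.prod_le_prod
      (fun i _ => mul_nonneg (Real.rpow_nonneg (hf i) _) (Real.rpow_nonneg (hg i) _))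
      (fun i _ => Real.geom_mean_le_arith_mean2_weighted ha hb (hf i) (hg i) hab)

/-- Frames with the same triangular shape can be averaged along with their centres, and the weighted
AM-GM inequality on each diagonal entry preserves the lower bound on the product. -/
theorem convex_triSet {d : ℕ} {K : Set (Euc d)} (hK : Convex ℝ K) {s : ℝ} (hs : 0 < s) :
    Convex ℝ (triSet K s) := by
  rintro x ⟨p, hp, hpM, hps⟩ y ⟨q, hq, hqM, hqs⟩ a b ha hb hab
  refine ⟨fun j => a • p j + b • q j, ⟨fun i j hij => ?_, fun j => ?_⟩, fun j => ⟨?_, ?_⟩, ?_⟩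
  · simp [hp.1 i j hij, hq.1 i j hij]
  · have h1 := hp.2 j
    have h2 := hq.2 j
    simp only [PiLp.add_apply, PiLp.smul_apply, smul_eq_mul]
    positivity
  · convert! hK (hpM j).1 (hqM j).1 ha hb hab using 1
    module
  · convert! hK (hpM j).2 (hqM j).2 ha hb hab using 1
    module
  · simpa using le_prod_convex_comb hp.2 hq.2 hs hps hqs ha hb hab

/-- Double counting of pairs `(a, y)` with `a` and its reflection `2y - a` both in `K`. For fixed
`a` the slice has volume `2^{-d} V(K)`; for fixed `y` it is a translate of the Macbeath region. -/
theorem volume_le_of_macbeath_le {d : ℕ} {K : Set (Euc d)} (hK : Convex ℝ K)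
    (hKm : MeasurableSet K) (hKf : volume K ≠ ⊤) {s : ENNReal}
    (h : ∀ᵐ y, y ∈ K → volume (macbeath K y) ≤ s) : volume K ≤ 2 ^ d * s := by
  by_cases h0 : volume K = 0
  · rw [h0]; exact zero_le
  set U : Set (Euc d × Euc d) := {q | q.1 ∈ K ∧ (2 : ℝ) • q.2 - q.1 ∈ K} with hU
  have hUm : MeasurableSet U :=
    (hKm.preimage measurable_fst).inter (hKm.preimage (by fun_prop))
  have h1 : ∀ a : Euc d, volume K = 2 ^ d * volume {y : Euc d | (2 : ℝ) • y - a ∈ K} := by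
    intro a
    have e : {y : Euc d | (2 : ℝ) • y - a ∈ K} = (fun y => (2 : ℝ) • y) ⁻¹' ((fun y => y - a) ⁻¹' K) :=
      rfl
    have hsub : volume ((fun y => y - a) ⁻¹' K) = volume K := by
      simp_rw [sub_eq_add_neg]
      exact measure_preimage_add_right _ _ _
    rw [e, Measure.addHaar_preimage_smul _ (by norm_num), hsub, ← mul_assoc,
      finrank_euclideanSpace, Fintype.card_fin, abs_of_pos (by positivity),
      ENNReal.ofReal_inv_of_pos (by positivity), ENNReal.ofReal_pow (by norm_num),
      ENNReal.ofReal_ofNat, ENNReal.mul_inv_cancel (by simp) (by simp), one_mul]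
  have h2 : volume K * volume K = 2 ^ d * (volume.prod volume) U := by
    rw [Measure.prod_apply hUm]
    have : ∀ a, volume (Prod.mk a ⁻¹' U) =
        K.indicator (fun a => volume {y : Euc d | (2 : ℝ) • y - a ∈ K}) a := by
      intro a
      by_cases ha : a ∈ K
      · rw [indicator_of_mem ha]; congr 1; ext y; simp [hU, ha]
      · rw [indicator_of_notMem ha]
        have : Prod.mk a ⁻¹' U = ∅ := by ext y; simp [hU, ha]
        rw [this, measure_empty]
    simp_rw [this]
    rw [lintegral_indicator hKm, ← lintegral_const_mul' _ _ (by simp)]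
    simp_rw [← h1]
    simp
  have h3 : (volume.prod volume) U ≤ s * volume K := by
    rw [Measure.prod_apply_symm hUm]
    have : ∀ᵐ y : Euc d, volume ((fun a => (a, y)) ⁻¹' U) ≤ K.indicator (fun _ => s) y := by
      filter_upwards [h] with y hy
      have e : (fun a => (a, y)) ⁻¹' U = (fun a => -y + a) ⁻¹' macbeath K y := by
        ext a
        simp only [hU, macbeath, mem_preimage, mem_ofPred_eq]
        have e1 : y + (-y + a) = a := by abel
        have e2 : y - (-y + a) = (2 : ℝ) • y - a := by rw [two_smul]; abel
        rw [e1, e2]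
      rw [e, measure_preimage_add]
      by_cases hyK : y ∈ K
      · rw [indicator_of_mem hyK]; exact hy hyK
      · rw [indicator_of_notMem hyK]
        have : macbeath K y = ∅ := by
          refine eq_empty_of_forall_notMem fun p hp => hyK ?_
          have := hK hp.1 hp.2 (a := 1 / 2) (b := 1 / 2) (by norm_num) (by norm_num) (by norm_num)
          convert! this using 1
          module
        rw [this, measure_empty]
    refine (lintegral_mono_ae this).trans ?_
    rw [lintegral_indicator hKm]
    simp
  refine (ENNReal.mul_le_mul_iff_left h0 hKf).1 ?_
  rw [h2, mul_assoc]
  gcongr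

/-- The dimensional constant comparing the volume of a symmetric body with its greedy triangular
frame. -/
def greedyConst (d : ℕ) : ℝ := 2 ^ d * (2 ^ d * ∏ j : Fin d, 2 ^ (j : ℕ))

theorem greedyConst_pos (d : ℕ) : 0 < greedyConst d := by
  have : 0 < ∏ j : Fin d, (2 : ℝ) ^ (j : ℕ) := Finset.prod_pos fun i _ => by positivity
  unfold greedyConst; positivity

/-- If `z` were outside the convex set `triSet K s`, a half-space `H` through `z` would miss its
interior. Almost every point of `K ∩ H` then has only small greedy frames, hence a small Macbeath
region, and averaging makes `K ∩ H` itself too small. -/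
theorem mem_triSet_of_lt_capVol {d : ℕ} (hd : 1 ≤ d) {K : Set (Euc d)} (hK : Convex ℝ K)
    (hKc : IsCompact K) {z : Euc d} {s : ℝ} (hs : 0 < s)
    (h : greedyConst d * s < capVol K z) : z ∈ triSet K s := by
  by_contra hz
  obtain ⟨u, hu0, hu⟩ : ∃ u : Euc d, u ≠ 0 ∧ ∀ y ∈ interior (triSet K s), inner ℝ u y < inner ℝ u z := by
    rcases (interior (triSet K s)).eq_empty_or_nonempty with he | ⟨y, hy⟩
    · have : Nonempty (Fin d) := ⟨⟨0, hd⟩⟩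
      obtain ⟨u, hu⟩ := exists_ne (0 : Euc d)
      exact ⟨u, hu, by simp [he]⟩
    · obtain ⟨f, hf⟩ := geometric_hahn_banach_open_point (convex_triSet hK hs).interior
        isOpen_interior (fun h => hz (interior_subset h))
      have hfi : ∀ x, inner ℝ ((InnerProductSpace.toDual ℝ (Euc d)).symm f) x = f x := fun x =>
        InnerProductSpace.toDual_symm_apply
      refine ⟨(InnerProductSpace.toDual ℝ (Euc d)).symm f, fun h0 => ?_, fun y hy => ?_⟩
      · have := hf y hy
        rw [← hfi, ← hfi, h0] at this
        simp at this
      · rw [hfi, hfi]; exact hf y hy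
  set H : Set (Euc d) := {x | inner ℝ u z ≤ inner ℝ u x} with hH
  have hHcl : IsClosed H := isClosed_le (by fun_prop) (by fun_prop)
  have hHconv : Convex ℝ H := by
    intro x hx y hy a b ha hb hab
    simp only [hH, mem_ofPred_eq] at *
    rw [inner_add_right, inner_smul_right, inner_smul_right]
    calc inner ℝ u z = a * inner ℝ u z + b * inner ℝ u z := by rw [← add_mul, hab, one_mul]
      _ ≤ _ := by gcongr
  -- `H` avoids only the interior of `triSet K s`; its frontier is null by convexity.
  have hfr : ∀ᵐ y, y ∉ frontier (triSet K s) :=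
    measure_eq_zero_iff_ae_notMem.1 ((convex_triSet hK hs).addHaar_frontier volume)
  have hvol := volume_le_of_macbeath_le (hK.inter hHconv)
    (hKc.isClosed.inter hHcl).measurableSet (hKc.inter_right hHcl).measure_lt_top.ne
    (s := ENNReal.ofReal (2 ^ d * ((∏ j : Fin d, 2 ^ (j : ℕ)) * s))) (by
      filter_upwards [hfr] with y hy hyK
      have hyt : y ∉ triSet K s := by
        intro hyt
        by_cases hyi : y ∈ interior (triSet K s)
        · exact absurd (hu y hyi) (not_lt.2 hyK.2)
        · exact hy ⟨subset_closure hyt, hyi⟩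
      have hsub : macbeath (K ∩ H) y ⊆ macbeath K y := fun p hp => ⟨hp.1.1, hp.2.1⟩
      obtain ⟨p, hp, hpM, hmax⟩ := exists_greedy_tri (isCompact_macbeath hKc y)
        (show (0 : Euc d) ∈ macbeath K y from ⟨by simpa using hyK.1, by simpa using hyK.1⟩)
      refine (measure_mono hsub).trans ((volume_le_of_greedy_tri (convex_macbeath hK y)
        (fun _ => neg_mem_macbeath) hp hpM hmax).trans (ENNReal.ofReal_le_ofReal ?_))
      have hlt : ∏ j, p j j ≤ s := by
        by_contra hcon
        exact hyt ⟨p, hp, hpM, (not_le.1 hcon).le⟩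
      rw [Finset.prod_mul_distrib]
      gcongr)
  have h1 := capVol_le (K := K) (H := H) (z := z) ⟨u, _, hu0, hH⟩ (by simp [hH])
  have h2 : volume.real (K ∩ H) ≤ greedyConst d * s := by
    refine ENNReal.toReal_le_of_le_ofReal (by have := greedyConst_pos d; positivity) (hvol.trans ?_)
    have e : (2 : ENNReal) ^ d = ENNReal.ofReal (2 ^ d) := by
      rw [ENNReal.ofReal_pow (by norm_num), ENNReal.ofReal_ofNat]
    rw [e, ← ENNReal.ofReal_mul (by positivity), greedyConst]
    exact ENNReal.ofReal_le_ofReal (le_of_eq (by ring))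
  linarith


/-! ### The estimate inside one simplex. -/

theorem add_sum_smul_mem {E ι : Type*} [AddCommGroup E] [Module ℝ E] [Fintype ι] {K : Set E}
    (hK : Convex ℝ K) {c : E} (hc : c ∈ K) {w : ι → E} (hw : ∀ i, c + w i ∈ K) {l : ι → ℝ}
    (hl : ∀ i, 0 ≤ l i) (hl1 : ∑ i, l i ≤ 1) : c + ∑ i, l i • w i ∈ K := by
  have := hK.sum_mem (t := Finset.univ) (w := fun o : Option ι => o.elim (1 - ∑ i, l i) l)
    (z := fun o : Option ι => o.elim c fun i => c + w i)
    (by rintro (_ | i) -; exacts [sub_nonneg.2 hl1, hl i])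
    (by simp [Fintype.sum_option]) (by rintro (_ | i) -; exacts [hc, hw i])
  rw [Fintype.sum_option] at this
  convert! this using 1
  simp only [Option.elim, smul_add, Finset.sum_add_distrib, sub_smul, one_smul, ← Finset.sum_smul]
  abel

/-- The parallelepiped around the midpoint is the average of one around `c + l`, with edges `(l i /
d) • e i`, and one around `z`, with edges `(1 / d) • p i`. The prolonged edges give the first, the
Macbeath region the second. -/
theorem le_capVol_midpoint {d : ℕ} (hd : 1 ≤ d) {K : Set (Euc d)} (hK : Convex ℝ K)
    (hKc : IsCompact K) {z c : Euc d} (hc : c ∈ K)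
    (hci : ∀ i, c + (1 + 1 / (d : ℝ)) • EuclideanSpace.single i (1 : ℝ) ∈ K)
    {p : Fin d → Euc d} (hp : IsTri p) (hpM : ∀ j, p j ∈ macbeath K z) {l : Euc d}
    (hl : ∀ i, 0 ≤ l i) (hl1 : ∑ i, l i ≤ 1) :
    (∏ i, (l i + p i i)) / (2 * d ^ d) ≤ capVol K ((1 / 2 : ℝ) • (c + l + z)) := by
  have hd0 : (0 : ℝ) < d := by exact_mod_cast hd
  have hz : z ∈ K := by
    have := hK (hpM ⟨0, hd⟩).1 (hpM ⟨0, hd⟩).2 (a := 1 / 2) (b := 1 / 2) (by norm_num)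
      (by norm_num) (by norm_num)
    convert! this using 1
    module
  set e : Fin d → Euc d := fun i => EuclideanSpace.single i (1 : ℝ) with he
  have hlsum : l = ∑ i, l i • e i := by
    simpa [he] using ((EuclideanSpace.basisFun (Fin d) ℝ).sum_repr l).symm
  set q : Fin d → Euc d := fun i => (1 / (2 * d) : ℝ) • (l i • e i + p i) with hq
  have hqt : IsTri q := by
    refine ⟨fun i j hij => ?_, fun j => ?_⟩
    · simp [hq, he, hp.1 i j hij, hij.ne]
    · have h1 := hl j
      have h2 := hp.2 j
      have : q j j = (1 / (2 * d) : ℝ) * (l j + p j j) := by simp [hq, he]; ring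
      rw [this]; positivity
  have hmain := le_capVol_of_tri hd (K := K) (m := (1 / 2 : ℝ) • (c + l + z))
    hKc.measure_lt_top.ne hqt (by
      intro s hs
      have h1 : c + ∑ i, l i • ((1 + s i / d) • e i) ∈ K := by
        refine add_sum_smul_mem hK hc (fun i => ?_) hl hl1
        have hsi := abs_le.1 (hs i)
        -- Since `0 ≤ 1 + s i / d ≤ 1 + 1 / d`, the point lies on the prolonged edge.
        have hseg := hK.add_smul_sub_mem hc (hci i) (t := (1 + s i / d) / (1 + 1 / d)) ?_
        · convert! hseg using 2
          rw [add_sub_cancel_left, smul_smul, div_mul_cancel₀ _ (by positivity)]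
        · have h3 : -1 ≤ s i / d := by
            rw [le_div_iff₀ hd0]
            have : (1 : ℝ) ≤ d := by exact_mod_cast hd
            linarith
          constructor
          · have : 0 ≤ 1 + s i / d := by linarith
            positivity
          · rw [div_le_one (by positivity)]
            gcongr; exact hsi.2
      have h2 : z + ∑ i, (1 / d : ℝ) • (s i • p i) ∈ K := by
        refine add_sum_smul_mem hK hz (fun i => ?_) (fun i => by positivity) (by simp [hd0.ne'])
        exact (smul_mem_of_symm (convex_macbeath hK z) (fun _ => neg_mem_macbeath) (hpM i)
          (hs i)).1
      have h3 := hK h1 h2 (a := 1 / 2) (b := 1 / 2) (by norm_num) (by norm_num) (by norm_num)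
      convert! h3 using 1
      conv_lhs => rw [hlsum]
      have hterm : ∀ i, (1 / 2 : ℝ) • l i • e i + s i • q i =
          (1 / 2 : ℝ) • l i • (1 + s i / d) • e i + (1 / 2 : ℝ) • (1 / d : ℝ) • s i • p i := by
        intro i
        simp only [hq]
        module
      have hsum := Finset.sum_congr (rfl : (Finset.univ : Finset (Fin d)) = _) fun i _ => hterm i
      rw [Finset.sum_add_distrib, Finset.sum_add_distrib, ← Finset.smul_sum, ← Finset.smul_sum,
        ← Finset.smul_sum] at hsum
      linear_combination (norm := module) hsum)
  refine le_trans (le_of_eq ?_) hmain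
  have : ∀ i, q i i = (1 / (2 * d) : ℝ) * (l i + p i i) := by
    intro i; simp [hq, he]; ring
  simp_rw [this]
  rw [Finset.prod_mul_distrib]
  simp only [Finset.prod_const, Finset.card_univ, Fintype.card_fin]
  rw [div_pow, mul_pow, one_pow]
  field_simp

/-- The constant of the simplex estimate in dimension `n + 1`. -/
def simplexConst (n : ℕ) : ℝ :=
  2 * ((n + 1 : ℕ) : ℝ) ^ (n + 1) *
    (1 + |Real.log (4 * ((n + 1 : ℕ) : ℝ) ^ (n + 1) * greedyConst (n + 1))| / Real.log 2) ^ n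

theorem simplexConst_pos (n : ℕ) : 0 < simplexConst n := by
  have : 0 < Real.log 2 := Real.log_pos (by norm_num)
  unfold simplexConst; positivity

/-- For `x ≥ 2` the additive term `log C` becomes a constant factor; with `x = T / v(z)` this uses
`2 v(z) ≤ T`. -/
theorem log_mul_le {C x : ℝ} (hC : 0 < C) (hx : 2 ≤ x) :
    Real.log (C * x) ≤ (1 + |Real.log C| / Real.log 2) * Real.log x := by
  have h2 : 0 < Real.log 2 := Real.log_pos (by norm_num)
  have hx2 : Real.log 2 ≤ Real.log x := Real.log_le_log (by norm_num) hx
  rw [Real.log_mul hC.ne' (by linarith), add_mul, one_mul, add_comm]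
  gcongr
  refine (le_abs_self _).trans ?_
  rw [div_mul_eq_mul_div, le_div_iff₀ h2]
  gcongr

theorem volume_standard_simplex_le {n : ℕ} {K : Set (Euc (n + 1))} (hK : Convex ℝ K)
    (hKc : IsCompact K) {z c : Euc (n + 1)} (hc : c ∈ K)
    (hci : ∀ i, c + (1 + 1 / ((n + 1 : ℕ) : ℝ)) • EuclideanSpace.single i (1 : ℝ) ∈ K) {T : ℝ}
    (hz : 0 < capVol K z) (hT : 2 * capVol K z ≤ T) :
    volume {l : Euc (n + 1) | (∀ i, 0 ≤ l i) ∧ ∑ i, l i ≤ 1 ∧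
      capVol K ((1 / 2 : ℝ) • (c + l + z)) < T} ≤
      ENNReal.ofReal (simplexConst n * (T * Real.log (T / capVol K z) ^ n)) := by
  set A := {l : Euc (n + 1) | (∀ i, 0 ≤ l i) ∧ ∑ i, l i ≤ 1 ∧
      capVol K ((1 / 2 : ℝ) • (c + l + z)) < T} with hA
  set t := capVol K z with ht
  have hG := greedyConst_pos (n + 1)
  set G := greedyConst (n + 1) with hGdef
  have hs0 : 0 < t / (2 * G) := by positivity
  obtain ⟨p, hp, hpM, hps⟩ := mem_triSet_of_lt_capVol (by omega) hK hKc hs0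
    -- The extra factor 2 in `t / (2 * G)` makes the inequality strict.
    (show G * (t / (2 * G)) < t by field_simp; linarith)
  have hprod : 0 < ∏ j, p j j := hs0.trans_le hps
  have hμ : ∀ j, 0 < p j j := fun j => (hp.2 j).lt_of_ne'
    (fun h => hprod.ne' (Finset.prod_eq_zero (Finset.mem_univ j) h))
  set D : ℝ := ((n + 1 : ℕ) : ℝ) ^ (n + 1) with hD
  have hD0 : 0 < D := by positivity
  have hsub : A ⊆ {l : Euc (n + 1) | (∀ i, 0 ≤ l i) ∧ ∏ i, (l i + p i i) < 2 * D * T} := by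
    rintro l ⟨hl, hl1, hlT⟩
    refine ⟨hl, ?_⟩
    have := (le_capVol_midpoint (by omega) hK hKc hc hci hp hpM hl hl1).trans_lt hlT
    rwa [div_lt_iff₀ (by positivity), mul_comm] at this
  -- A point of `A` is what guarantees `∏ p j j ≤ 2 * D * T`, so that the logarithm is nonnegative.
  rcases A.eq_empty_or_nonempty with he | ⟨l, hl⟩
  · rw [he, measure_empty]; exact zero_le
  have hN : ∏ j, p j j ≤ 2 * D * T := by
    refine le_trans (Finset.prod_le_prod (fun i _ => hp.2 i) fun i _ => ?_) (hsub hl).2.le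
    exact le_add_of_nonneg_left (hl.1 i)
  refine (measure_mono hsub).trans ((volume_prod_add_lt_le _ hμ _ hN).trans
    (ENNReal.ofReal_le_ofReal ?_))
  have hT0 : 0 < T := by linarith
  have h0 : 0 ≤ Real.log (2 * D * T / ∏ j, p j j) :=
    Real.log_nonneg ((one_le_div hprod).2 hN)
  have h1 : Real.log (2 * D * T / ∏ j, p j j) ≤
      (1 + |Real.log (4 * D * G)| / Real.log 2) * Real.log (T / t) := by
    refine le_trans (Real.log_le_log (by positivity) ?_)
      (log_mul_le (C := 4 * D * G) (x := T / t) (by positivity) ((le_div_iff₀ hz).2 hT))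
    calc 2 * D * T / ∏ j, p j j ≤ 2 * D * T / (t / (2 * G)) := by gcongr
      _ = _ := by field_simp; ring
  calc 2 * D * T * Real.log (2 * D * T / ∏ j, p j j) ^ n ≤
      2 * D * T * ((1 + |Real.log (4 * D * G)| / Real.log 2) * Real.log (T / t)) ^ n := by gcongr
    _ = _ := by rw [mul_pow, simplexConst]; ring

theorem IsHalfSpace.image {d : ℕ} {H : Set (Euc d)} (hH : IsHalfSpace H)
    (A : Euc d ≃ₗ[ℝ] Euc d) : IsHalfSpace (A '' H) := by
  obtain ⟨u, t, hu, rfl⟩ := hH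
  have h : ∀ y, inner ℝ (LinearMap.adjoint (A.symm : Euc d →ₗ[ℝ] Euc d) u) y =
      inner ℝ u (A.symm y) := fun y => by
    rw [LinearMap.adjoint_inner_left]; rfl
  refine ⟨LinearMap.adjoint (A.symm : Euc d →ₗ[ℝ] Euc d) u, t, fun h0 => hu ?_, ?_⟩
  · have := h (A u)
    rw [h0, inner_zero_left, LinearEquiv.symm_apply_apply] at this
    exact inner_self_eq_zero.1 this.symm
  · ext y
    simp only [mem_ofPred_eq, h]
    constructor
    · rintro ⟨x, hx, rfl⟩
      simpa using hx
    · intro hy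
      exact ⟨A.symm y, hy, by simp⟩

theorem capVol_image_le {d : ℕ} (hd : 1 ≤ d) (K : Set (Euc d)) (z : Euc d)
    (A : Euc d ≃ₗ[ℝ] Euc d) :
    capVol (A '' K) (A z) ≤ |LinearMap.det (A : Euc d →ₗ[ℝ] Euc d)| * capVol K z := by
  have hdet : 0 < |LinearMap.det (A : Euc d →ₗ[ℝ] Euc d)| := abs_pos.2 A.isUnit_det'.ne_zero
  rw [← div_le_iff₀' hdet]
  refine le_csInf (capVol_set_nonempty hd K z) ?_
  rintro _ ⟨H, hH, hz, rfl⟩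
  rw [div_le_iff₀' hdet]
  refine (capVol_le (hH.image A) (mem_image_of_mem _ hz)).trans (le_of_eq ?_)
  rw [← image_inter A.injective, measureReal_def, measureReal_def,
    show (A '' (K ∩ H)) = (A : Euc d →ₗ[ℝ] Euc d) '' (K ∩ H) from rfl,
    Measure.addHaar_image_linearMap, ENNReal.toReal_mul, ENNReal.toReal_ofReal hdet.le]

theorem capVol_image {d : ℕ} (hd : 1 ≤ d) (K : Set (Euc d)) (z : Euc d)
    (A : Euc d ≃ₗ[ℝ] Euc d) :
    capVol (A '' K) (A z) = |LinearMap.det (A : Euc d →ₗ[ℝ] Euc d)| * capVol K z := by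
  have hdet : 0 < |LinearMap.det (A : Euc d →ₗ[ℝ] Euc d)| := abs_pos.2 A.isUnit_det'.ne_zero
  refine (capVol_image_le hd K z A).antisymm ?_
  have := capVol_image_le hd (A '' K) (A z) A.symm
  rw [show A.symm '' (A '' K) = K by rw [image_image]; simp] at this
  simp only [LinearEquiv.symm_apply_apply] at this
  have h2 : LinearMap.det (A.symm : Euc d →ₗ[ℝ] Euc d) *
      LinearMap.det (A : Euc d →ₗ[ℝ] Euc d) = 1 := LinearEquiv.det_symm_mul_det A
  have h3 := congrArg abs h2
  rw [abs_mul, abs_one] at h3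
  calc _ ≤ |LinearMap.det (A : Euc d →ₗ[ℝ] Euc d)| *
        (|LinearMap.det (A.symm : Euc d →ₗ[ℝ] Euc d)| * capVol (A '' K) (A z)) := by gcongr
    _ = _ := by rw [← mul_assoc, mul_comm |LinearMap.det (A : Euc d →ₗ[ℝ] Euc d)|, h3, one_mul]

/-- `T`, cap volumes and Lebesgue measure all scale by the same determinant, so the ratio in the
logarithm is unchanged by the passage to standard edges. A degenerate simplex is null. -/
theorem volume_simplex_le {n : ℕ} {P : Set (Euc (n + 1))} (hP : Convex ℝ P)
    (hPc : IsCompact P) {z c : Euc (n + 1)} (hc : c ∈ P) {g : Fin (n + 1) → Euc (n + 1)}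
    (hci : ∀ i, c + (1 + 1 / ((n + 1 : ℕ) : ℝ)) • g i ∈ P) {T : ℝ}
    (hz : 0 < capVol P z) (hT : 2 * capVol P z ≤ T) :
    volume {x : Euc (n + 1) | (∃ l : Euc (n + 1), (∀ i, 0 ≤ l i) ∧ ∑ i, l i ≤ 1 ∧
      x = c + ∑ i, l i • g i) ∧ capVol P ((1 / 2 : ℝ) • (x + z)) < T} ≤
      ENNReal.ofReal (simplexConst n * (T * Real.log (T / capVol P z) ^ n)) := by
  by_cases h0 : LinearMap.det (frameMap g) = 0
  · refine le_trans (measure_mono (t := (fun x => c + x) '' (frameMap g '' univ)) ?_) ?_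
    · rintro x ⟨⟨l, -, -, rfl⟩, -⟩
      exact ⟨_, ⟨l, trivial, rfl⟩, by rw [frameMap_apply]⟩
    · rw [image_add_left, measure_preimage_add, Measure.addHaar_image_linearMap, h0]
      simp
  · set A : Euc (n + 1) ≃ₗ[ℝ] Euc (n + 1) := (frameMap g).equivOfDetNeZero h0 with hA
    have hAg : ∀ x, A x = ∑ i, x i • g i := fun x => frameMap_apply g x
    have hAdet : LinearMap.det (A : Euc (n + 1) →ₗ[ℝ] Euc (n + 1)) = LinearMap.det (frameMap g) :=
      rfl
    set D := |LinearMap.det (frameMap g)| with hD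
    have hD0 : 0 < D := abs_pos.2 h0
    set K := A.symm '' P with hKdef
    have hKP : A '' K = P := by rw [hKdef, image_image]; simp
    have hcap : ∀ y, capVol P (A y) = D * capVol K y := by
      intro y
      rw [← hKP, capVol_image (by omega), hAdet]
    have hKc : IsCompact K := hPc.image (LinearMap.continuous_of_finiteDimensional
      (A.symm : Euc (n + 1) →ₗ[ℝ] Euc (n + 1)))
    have hzc : capVol P z = D * capVol K (A.symm z) := by rw [← hcap, A.apply_symm_apply]
    have hAs : ∀ i, A (EuclideanSpace.single i 1) = g i := by
      intro i; rw [hAg]; simp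
    have hmain := volume_standard_simplex_le (K := K) (hP.linear_image A.symm.toLinearMap) hKc
      (z := A.symm z) (c := A.symm c) (mem_image_of_mem _ hc) (T := T / D)
      (fun i => ⟨_, hci i, by
        rw [map_add, map_smul, ← hAs, LinearEquiv.symm_apply_apply]⟩)
      (by rw [hzc] at hz; exact pos_of_mul_pos_right hz hD0.le)
      (by rw [le_div_iff₀ hD0]; rw [hzc] at hT; linarith)
    set B := {l : Euc (n + 1) | (∀ i, 0 ≤ l i) ∧ ∑ i, l i ≤ 1 ∧
        capVol K ((1 / 2 : ℝ) • (A.symm c + l + A.symm z)) < T / D} with hB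
    refine le_trans (measure_mono (t := (fun x => c + x) '' (A.toLinearMap '' B)) ?_) ?_
    · rintro x ⟨⟨l, hl, hl1, rfl⟩, hx⟩
      refine ⟨_, ⟨l, ⟨hl, hl1, ?_⟩, rfl⟩, by rw [← hAg]; rfl⟩
      rw [lt_div_iff₀' hD0, ← hcap]
      rw [map_smul, map_add, map_add, A.apply_symm_apply, A.apply_symm_apply, hAg]
      exact hx
    · rw [image_add_left, measure_preimage_add, Measure.addHaar_image_linearMap, hAdet]
      refine (mul_le_mul_right hmain _).trans ?_
      rw [← ENNReal.ofReal_mul hD0.le]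
      refine ENNReal.ofReal_le_ofReal (le_of_eq ?_)
      rw [hzc]
      have : T / D / capVol K (A.symm z) = T / (D * capVol K (A.symm z)) := by
        rw [div_div]
      rw [this]
      field_simp


/-! ### Central points of convex sets. -/

/-- For each `y` the admissible `c` form a homothetic copy `A y` of `F`. Any `d + 1` or fewer of
these copies share the centroid of their points `y`, so Helly's theorem gives a common point. -/
theorem exists_central_point {d : ℕ} (hd : 1 ≤ d) {F : Set (Euc d)} (hF : Convex ℝ F)
    (hFc : IsCompact F) (hne : F.Nonempty) :
    ∃ c ∈ F, ∀ y ∈ F, c + (1 / (d : ℝ)) • (c - y) ∈ F := by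
  have hd0 : (0 : ℝ) < d := by exact_mod_cast hd
  set A : F → Set (Euc d) := fun y => (fun f => 
    (1 / ((d : ℝ) + 1)) • (y : Euc d) + ((d : ℝ) / (d + 1)) • f) '' F with hA
  have hmem : ∀ (y : F) (c : Euc d), c + (1 / (d : ℝ)) • (c - y) ∈ F → c ∈ A y := by
    intro y c hc
    refine ⟨_, hc, ?_⟩
    match_scalars <;> (field_simp; try ring)
  have hmem' : ∀ (y : F) (c : Euc d), c ∈ A y → c + (1 / (d : ℝ)) • (c - y) ∈ F := by
    rintro y c ⟨f, hf, rfl⟩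
    convert! hf using 1
    match_scalars <;> (field_simp; try ring)
  obtain ⟨c, hc⟩ := Convex.helly_theorem_compact' (𝕜 := ℝ) (F := A) (fun y => by
      have h1 : A y = (fun z => (1 / ((d : ℝ) + 1)) • (y : Euc d) + z) ''
          ((fun f => ((d : ℝ) / (d + 1)) • f) '' F) := by rw [image_image]
      rw [h1]
      have h2 : Convex ℝ ((fun f => ((d : ℝ) / (d + 1)) • f) '' F) := hF.smul _
      exact h2.translate _)
    (fun y => hFc.image (by fun_prop)) (by
      intro I hI
      rcases I.eq_empty_or_nonempty with rfl | hIne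
      · simp
      have hk0 : (0 : ℝ) < I.card := by exact_mod_cast hIne.card_pos
      have hk : (I.card : ℝ) ≤ d + 1 := by
        rw [finrank_euclideanSpace, Fintype.card_fin] at hI
        exact_mod_cast hI
      refine ⟨∑ i ∈ I, (1 / (I.card : ℝ)) • (i : Euc d), mem_iInter₂.2 fun j hj => hmem _ _ ?_⟩
      classical
      -- The weight of `j` is `(1 + 1/d) / k - 1/d` with `k = I.card`, which is nonnegative exactly
      -- when `k ≤ d + 1`.
      have := hF.sum_mem (t := I) (z := fun i => (i : Euc d))
        (w := fun i => (1 + 1 / (d : ℝ)) * (1 / I.card) - if i = j then 1 / (d : ℝ) else 0)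
        (fun i _ => by
          have : 1 / (d : ℝ) ≤ (1 + 1 / (d : ℝ)) * (1 / I.card) := by
            rw [mul_one_div, le_div_iff₀ hk0]
            field_simp; linarith
          have h0 : 0 < 1 / (d : ℝ) := by positivity
          split_ifs <;> linarith)
        (by
          rw [Finset.sum_sub_distrib, Finset.sum_ite_eq' I j, if_pos hj]
          simp only [Finset.sum_const, nsmul_eq_mul]
          field_simp; ring)
        (fun i _ => i.2)
      convert! this using 1
      simp only [sub_smul, Finset.sum_sub_distrib, ite_smul, zero_smul, Finset.sum_ite_eq', if_pos hj,
        mul_smul, ← Finset.smul_sum]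
      module)
  rw [mem_iInter] at hc
  obtain ⟨y, hy⟩ := hne
  refine ⟨c, ?_, fun y hy => hmem' ⟨y, hy⟩ c (hc ⟨y, hy⟩)⟩
  obtain ⟨f, hf, rfl⟩ := hc ⟨y, hy⟩
  exact hF hy hf (by positivity) (by positivity) (by field_simp; ring)

/-! ### Faces and facets of polytopes. -/

section Faces

variable {E : Type*} [NormedAddCommGroup E] [NormedSpace ℝ E]

theorem IsExposed.eq_convexHull_inter {W : Finset E} {F : Set E}
    (hF : IsExposed ℝ (convexHull ℝ (W : Set E)) F) : F = convexHull ℝ ((W : Set E) ∩ F) := by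
  have hPc : IsCompact (convexHull ℝ (W : Set E)) := W.finite_toSet.isCompact_convexHull ℝ
  have hFc := hF.isCompact hPc
  have hFconv := hF.convex (convex_convexHull ℝ _)
  refine Subset.antisymm ?_ (convexHull_min inter_subset_right hFconv)
  have hsub : F.extremePoints ℝ ⊆ (W : Set E) ∩ F := fun x hx =>
    ⟨extremePoints_convexHull_subset (hF.isExtreme.extremePoints_subset_extremePoints hx), hx.1⟩
  have hcl : IsClosed (convexHull ℝ ((W : Set E) ∩ F)) :=
    ((W.finite_toSet.inter_of_left F).isCompact_convexHull ℝ).isClosed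
  calc F = closure (convexHull ℝ (F.extremePoints ℝ)) :=
        (closure_convexHull_extremePoints hFc hFconv).symm
    _ ⊆ closure (convexHull ℝ ((W : Set E) ∩ F)) := closure_mono (convexHull_mono hsub)
    _ = _ := hcl.closure_eq

theorem le_of_mem_convexHull {S : Set E} (l : E →ₗ[ℝ] ℝ) {M : ℝ} (h : ∀ w ∈ S, l w ≤ M) {x : E}
    (hx : x ∈ convexHull ℝ S) : l x ≤ M :=
  convexHull_min (t := {x | l x ≤ M}) h (convex_halfSpace_le l.isLinear M) hx

theorem exists_pos_forall_add_mul_lt {ι : Type*} (W : Finset ι) (f g : ι → ℝ) (a b : ℝ)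
    (h : ∀ w ∈ W, f w < a) : ∃ ε : ℝ, 0 < ε ∧ ∀ w ∈ W, f w + ε * g w < a + ε * b := by
  have h1 : ∀ w ∈ W, ∀ᶠ ε in nhdsWithin (0 : ℝ) (Ioi 0), f w + ε * g w < a + ε * b := by
    intro w hw
    refine Filter.Eventually.filter_mono nhdsWithin_le_nhds ?_
    refine ContinuousAt.eventually_lt (by fun_prop) (by fun_prop) ?_
    simpa using h w hw
  obtain ⟨ε, h2, h3⟩ := (((Finset.eventually_all W).2 h1).and self_mem_nhdsWithin).exists
  exact ⟨ε, h3, h2⟩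

/-- The functional `l₁ + ε • l₂` exposes `G`: with finitely many generators, a small `ε` keeps those
outside `F` strictly below the maximum. -/
theorem IsExposed.trans_of_convexHull {W : Finset E} {F G : Set E}
    (hF : IsExposed ℝ (convexHull ℝ (W : Set E)) F) (hG : IsExposed ℝ F G) :
    IsExposed ℝ (convexHull ℝ (W : Set E)) G := by
  classical
  set P := convexHull ℝ (W : Set E) with hP
  rintro ⟨g, hg⟩
  have hgF : g ∈ F := hG.subset hg
  obtain ⟨l₁, h₁⟩ := hF ⟨g, hgF⟩
  obtain ⟨l₂, h₂⟩ := hG ⟨g, hg⟩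
  have hg1 : ∀ x ∈ P, l₁ x ≤ l₁ g := by rw [h₁] at hgF; exact hgF.2
  have hg2 : ∀ x ∈ F, l₂ x ≤ l₂ g := by rw [h₂] at hg; exact hg.2
  have hF1 : ∀ x ∈ P, l₁ g ≤ l₁ x → x ∈ F := fun x hx h => by
    rw [h₁]; exact ⟨hx, fun y hy => (hg1 y hy).trans h⟩
  obtain ⟨ε, hε, hεW⟩ := exists_pos_forall_add_mul_lt (W.filter (· ∉ F)) l₁ l₂ (l₁ g) (l₂ g) (by
    intro w hw
    rw [Finset.mem_filter] at hw
    by_contra hcon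
    exact hw.2 (hF1 w (subset_convexHull ℝ _ hw.1) (not_lt.1 hcon)))
  have hl : ∀ x, (l₁ + ε • l₂) x = l₁ x + ε * l₂ x := fun x => by simp
  have hW : ∀ w ∈ W, (l₁ + ε • l₂) w ≤ (l₁ + ε • l₂) g := by
    intro w hw
    rw [hl, hl]
    by_cases hwF : w ∈ F
    · have := hg1 w (subset_convexHull ℝ _ hw)
      have := hg2 w hwF
      gcongr
    · exact (hεW w (by simp [hw, hwF])).le
  have hmax : ∀ x ∈ P, (l₁ + ε • l₂) x ≤ (l₁ + ε • l₂) g := fun x hx =>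
    le_of_mem_convexHull (l₁ + ε • l₂ : E →L[ℝ] ℝ).toLinearMap hW hx
  refine ⟨l₁ + ε • l₂, Subset.antisymm ?_ ?_⟩
  · intro x hx
    have hxF : x ∈ F := hG.subset hx
    refine ⟨hF.subset hxF, fun y hy => (hmax y hy).trans ?_⟩
    have e1 : l₁ g ≤ l₁ x := by rw [h₁] at hxF; exact hxF.2 g (hF.subset hgF)
    have e2 : l₂ g ≤ l₂ x := by rw [h₂] at hx; exact hx.2 g hgF
    rw [hl, hl]
    gcongr
  · intro x hx
    have hE : IsExposed ℝ P ((l₁ + ε • l₂).toExposed P) :=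
      ContinuousLinearMap.toExposed.isExposed
    have hEF : (l₁ + ε • l₂).toExposed P ⊆ F := by
      rw [IsExposed.eq_convexHull_inter hE]
      refine convexHull_min ?_ (hF.convex (convex_convexHull ℝ _))
      rintro w ⟨hwW, hwE⟩
      by_contra hwF
      have h3 := hεW w (by simpa [hwF] using hwW)
      have h4 := hwE.2 g (hF.subset hgF)
      rw [hl, hl] at h4
      linarith
    have hxF : x ∈ F := hEF hx
    have h4 := hx.2 g (hF.subset hgF)
    rw [hl, hl] at h4
    have h5 := hg1 x hx.1
    have h6 : l₂ g ≤ l₂ x := by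
      by_contra hcon
      have : ε * l₂ x < ε * l₂ g := by gcongr; exact not_le.1 hcon
      linarith
    rw [h₂]
    exact ⟨hxF, fun y hy => (hg2 y hy).trans h6⟩

end Faces


section Facets

variable {E : Type*} [NormedAddCommGroup E] [NormedSpace ℝ E]

theorem map_eq_of_const_vectorSpan {F : Set E} {l : E →ₗ[ℝ] ℝ}
    (h : ∀ v ∈ vectorSpan ℝ F, l v = 0) {x y : E} (hx : x ∈ F) (hy : y ∈ F) : l x = l y := by
  have := h _ (vsub_mem_vectorSpan ℝ hx hy)
  rwa [vsub_eq_sub, map_sub, sub_eq_zero] at this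

theorem vectorSpan_le_ker {F : Set E} {l : E →ₗ[ℝ] ℝ} {a : ℝ} (h : ∀ x ∈ F, l x = a) :
    vectorSpan ℝ F ≤ LinearMap.ker l := by
  rw [vectorSpan_def, Submodule.span_le]
  rintro _ ⟨x, hx, y, hy, rfl⟩
  simp [h x hx, h y hy]

/-- `l` supports `F` at `y` and is not constant on `F`. -/
def SupportsAt (F : Set E) (y : E) (l : E →ₗ[ℝ] ℝ) : Prop :=
  (∀ x ∈ F, l x ≤ l y) ∧ ∃ x ∈ F, l x ≠ l y

/-- The face of `F` through `y` supported by `l`. -/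
def faceAt (F : Set E) (y : E) (l : E →ₗ[ℝ] ℝ) : Set E := {x ∈ F | l x = l y}

/-- The supporting hyperplane is rotated about the face until it meets another generator. -/
theorem exists_larger_face [FiniteDimensional ℝ E] {V : Set E} (hV : V.Finite) {y : E}
    (hy : y ∈ convexHull ℝ V) {l : E →ₗ[ℝ] ℝ} (hl : SupportsAt (convexHull ℝ V) y l)
    (hdim : Module.finrank ℝ (vectorSpan ℝ (faceAt (convexHull ℝ V) y l)) + 1 <
      Module.finrank ℝ (vectorSpan ℝ (convexHull ℝ V))) :
    ∃ l', SupportsAt (convexHull ℝ V) y l' ∧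
      Module.finrank ℝ (vectorSpan ℝ (faceAt (convexHull ℝ V) y l)) <
        Module.finrank ℝ (vectorSpan ℝ (faceAt (convexHull ℝ V) y l')) := by
  classical
  set F := convexHull ℝ V with hF
  set G := faceAt F y l with hG
  have hyG : y ∈ G := ⟨hy, rfl⟩
  -- The dimension gap of at least 2 leaves a direction of `F` in the kernel of `l` but outside the
  -- span of `G`; it will keep the rotated functional nonconstant on `F`.
  obtain ⟨v, hvF, hvl, hvG⟩ : ∃ v ∈ vectorSpan ℝ F, l v = 0 ∧ v ∉ vectorSpan ℝ G := by
    by_contra! hcon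
    have h1 : vectorSpan ℝ F ⊓ LinearMap.ker l ≤ vectorSpan ℝ G := fun v hv =>
      hcon v hv.1 hv.2
    have h2 := Submodule.finrank_mono h1
    have h3 := Submodule.finrank_sup_add_finrank_inf_eq (vectorSpan ℝ F) (LinearMap.ker l)
    have h4 := LinearMap.finrank_range_add_finrank_ker l
    have h5 : Module.finrank ℝ (LinearMap.range l) ≤ 1 := by
      simpa using Submodule.finrank_le (LinearMap.range l)
    have h6 := Submodule.finrank_le (vectorSpan ℝ F ⊔ LinearMap.ker l)
    omega
  obtain ⟨m₀, hm₀v, hm₀G⟩ := Submodule.exists_le_ker_of_notMem hvG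
  obtain ⟨m, hmv, hmG, w₀, hw₀, hw₀y⟩ : ∃ m : E →ₗ[ℝ] ℝ, m v ≠ 0 ∧
      (∀ u ∈ vectorSpan ℝ G, m u = 0) ∧ ∃ w ∈ V, m y < m w := by
    by_cases h : ∃ w ∈ V, m₀ y < m₀ w
    · exact ⟨m₀, hm₀v, fun u hu => hm₀G hu, h⟩
    · refine ⟨-m₀, by simpa using hm₀v, fun u hu => by simpa using hm₀G hu, ?_⟩
      by_contra! h2
      push Not at h
      apply hm₀v
      have h3 : ∀ x ∈ F, m₀ x = m₀ y := fun x hx => le_antisymm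
        (le_of_mem_convexHull m₀ h hx) (by
          have := le_of_mem_convexHull (-m₀) (M := -m₀ y) (fun w hw => by
            simpa using h2 w hw) hx
          simpa using this)
      exact vectorSpan_le_ker h3 hvF
  set S := hV.toFinset.filter (fun w => m y < m w) with hS
  have hSne : S.Nonempty := ⟨w₀, by simp [hS, hw₀, hw₀y]⟩
  -- `w₁` is the first generator reached as `s` grows in `l + s • m`.
  obtain ⟨w₁, hw₁S, hmin⟩ := S.exists_min_image (fun w => (l y - l w) / (m w - m y)) hSne
  obtain ⟨hw₁V, hw₁⟩ : w₁ ∈ V ∧ m y < m w₁ := by simpa [hS] using hw₁S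
  set s := (l y - l w₁) / (m w₁ - m y) with hs
  have hVF : V ⊆ F := subset_convexHull ℝ V
  have hw₁l : l w₁ < l y := lt_of_le_of_ne (hl.1 _ (hVF hw₁V)) (fun h =>
    hw₁.ne' (map_eq_of_const_vectorSpan hmG ⟨hVF hw₁V, h⟩ hyG))
  have hs0 : 0 < s := div_pos (by linarith) (by linarith)
  have hm : ∀ x, (l + s • m) x = l x + s * m x := fun x => by simp
  have hle : ∀ x ∈ F, (l + s • m) x ≤ (l + s • m) y := fun x hx =>
    le_of_mem_convexHull _ (fun w hw => by
      rw [hm, hm]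
      rcases le_or_gt (m w) (m y) with h | h
      · have := hl.1 w (hVF hw)
        gcongr
      · have h1 := hmin w (by simp [hS, hw, h])
        rw [le_div_iff₀ (by linarith)] at h1
        linarith) hx
  have hw₁eq : (l + s • m) w₁ = (l + s • m) y := by
    rw [hm, hm]
    have : s * (m w₁ - m y) = l y - l w₁ := by
      rw [hs, div_mul_cancel₀ _ (by linarith)]
    linarith
  refine ⟨l + s • m, ⟨hle, ?_⟩, ?_⟩
  · by_contra! hcon
    have h1 := vectorSpan_le_ker hcon hvF
    rw [LinearMap.mem_ker, hm, hvl, zero_add] at h1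
    exact mul_ne_zero hs0.ne' hmv h1
  · refine Submodule.finrank_lt_finrank_of_lt (lt_of_le_of_ne (vectorSpan_mono ℝ ?_) ?_)
    · intro x hx
      refine ⟨hx.1, ?_⟩
      rw [hm, hm, hx.2, map_eq_of_const_vectorSpan hmG hx hyG]
    · intro heq
      have h1 : w₁ -ᵥ y ∈ vectorSpan ℝ (faceAt F y (l + s • m)) :=
        vsub_mem_vectorSpan ℝ ⟨hVF hw₁V, hw₁eq⟩ ⟨hy, rfl⟩
      rw [← heq] at h1
      have := hmG _ h1
      rw [vsub_eq_sub, map_sub] at this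
      linarith

theorem exists_facet_of_supportsAt [FiniteDimensional ℝ E] {V : Set E} (hV : V.Finite) {y : E}
    (hy : y ∈ convexHull ℝ V) {k : ℕ}
    (hk : Module.finrank ℝ (vectorSpan ℝ (convexHull ℝ V)) = k + 1) {l : E →ₗ[ℝ] ℝ}
    (hl : SupportsAt (convexHull ℝ V) y l) :
    ∃ l', SupportsAt (convexHull ℝ V) y l' ∧
      Module.finrank ℝ (vectorSpan ℝ (faceAt (convexHull ℝ V) y l')) = k := by
  have hlt : ∀ l, SupportsAt (convexHull ℝ V) y l →
      Module.finrank ℝ (vectorSpan ℝ (faceAt (convexHull ℝ V) y l)) < k + 1 := by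
    rintro l ⟨-, x, hx, hxy⟩
    rw [← hk]
    refine Submodule.finrank_lt_finrank_of_lt (lt_of_le_of_ne
      (vectorSpan_mono ℝ fun x hx => hx.1) fun heq => hxy ?_)
    have h1 : x -ᵥ y ∈ vectorSpan ℝ (faceAt (convexHull ℝ V) y l) := by
      rw [heq]; exact vsub_mem_vectorSpan ℝ hx hy
    have h2 := vectorSpan_le_ker (l := l) (a := l y) (fun x hx => hx.2) h1
    rwa [LinearMap.mem_ker, vsub_eq_sub, map_sub, sub_eq_zero] at h2
  induction hj : k - Module.finrank ℝ (vectorSpan ℝ (faceAt (convexHull ℝ V) y l))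
    using Nat.strong_induction_on generalizing l with
  | _ j ih =>
    have h1 := hlt l hl
    by_cases h : Module.finrank ℝ (vectorSpan ℝ (faceAt (convexHull ℝ V) y l)) = k
    · exact ⟨l, hl, h⟩
    · obtain ⟨l', hl', h2⟩ := exists_larger_face hV hy hl (by omega)
      have h3 := hlt l' hl'
      exact ih _ (by omega) hl' rfl

theorem isExposed_faceAt [FiniteDimensional ℝ E] {F : Set E} {y : E} (hy : y ∈ F)
    {l : E →ₗ[ℝ] ℝ} (hl : SupportsAt F y l) : IsExposed ℝ F (faceAt F y l) := by
  refine fun _ => ⟨LinearMap.toContinuousLinearMap l, ?_⟩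
  ext x
  simp only [faceAt, mem_ofPred_eq, LinearMap.coe_toContinuousLinearMap']
  refine and_congr_right fun hx => ⟨fun h z hz => (hl.1 z hz).trans h.ge, fun h => ?_⟩
  exact le_antisymm (hl.1 x hx) (h y hy)

/-- A point beyond which the ray from `c` leaves `F` is a relative boundary point. Inside
`vectorSpan ℝ F` the set has nonempty interior, so Hahn-Banach separates strictly from interior
points and the functional is not constant on `F`. -/
theorem exists_supportsAt [FiniteDimensional ℝ E] {F : Set E} (hF : Convex ℝ F) {c y : E}
    (hc : c ∈ F) (hy : y ∈ F) (hout : ∀ s : ℝ, 1 < s → c + s • (y - c) ∉ F) :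
    ∃ l, SupportsAt F y l := by
  set S := vectorSpan ℝ F with hS
  set F' : Set S := {v | c + (v : E) ∈ F} with hF'
  have hF'conv : Convex ℝ F' := by
    intro u hu v hv a b ha hb hab
    have := hF hu hv ha hb hab
    simp only [hF', mem_ofPred_eq, Submodule.coe_add, Submodule.coe_smul]
    convert! this using 1
    rw [smul_add, smul_add, add_add_add_comm, ← add_smul, hab, one_smul]
  have hlift : ∀ x ∈ F, ∃ v ∈ F', (v : E) = x - c := fun x hx =>
    ⟨⟨x - c, vsub_mem_vectorSpan ℝ hx hc⟩, by simpa [hF'] using hx, rfl⟩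
  have h0 : (0 : S) ∈ F' := by simpa [hF'] using hc
  have htop : vectorSpan ℝ F' = ⊤ := by
    have h1 : S ≤ (vectorSpan ℝ F').map S.subtype := by
      conv_lhs => rw [hS, vectorSpan_def]
      rw [Submodule.span_le]
      rintro _ ⟨a, ha, b, hb, rfl⟩
      obtain ⟨u, hu, hua⟩ := hlift a ha
      obtain ⟨v, hv, hvb⟩ := hlift b hb
      refine ⟨u -ᵥ v, vsub_mem_vectorSpan ℝ hu hv, ?_⟩
      simp [hua, hvb]
    rw [eq_top_iff]
    rintro ⟨v, hv⟩ -
    obtain ⟨u, hu, huv⟩ := h1 hv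
    convert! hu using 1
    exact Subtype.ext huv.symm
  have hint : (interior F').Nonempty := by
    rw [hF'conv.interior_nonempty_iff_affineSpan_eq_top,
      AffineSubspace.affineSpan_eq_top_iff_vectorSpan_eq_top_of_nonempty ℝ _ _ ⟨0, h0⟩]
    exact htop
  obtain ⟨y', hy', hyc⟩ := hlift y hy
  have hyint : y' ∉ interior F' := by
    intro h
    have hcont : Filter.Tendsto (fun s : ℝ => s • y') (nhdsWithin 1 (Ioi 1)) (nhds y') := by
      have : ContinuousAt (fun s : ℝ => s • y') 1 := by fun_prop
      have h2 := this.tendsto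
      rw [one_smul] at h2
      exact h2.mono_left nhdsWithin_le_nhds
    obtain ⟨s, hs1, hs2⟩ := ((hcont.eventually (mem_interior_iff_mem_nhds.1 h)).and
      self_mem_nhdsWithin).exists
    refine hout s hs2 ?_
    rw [← hyc]
    exact hs1
  obtain ⟨f, hf⟩ := geometric_hahn_banach_open_point hF'conv.interior isOpen_interior hyint
  obtain ⟨l, hl⟩ := LinearMap.exists_extend (f : S →ₗ[ℝ] ℝ)
  have hlf : ∀ v : S, l v = f v := fun v => LinearMap.congr_fun hl v
  have hle : ∀ v ∈ F', f v ≤ f y' := by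
    intro v hv
    have h1 : v ∈ closure (interior F') := by
      rw [hF'conv.closure_interior_eq_closure_of_nonempty_interior hint]
      exact subset_closure hv
    exact closure_minimal (t := {v | f v ≤ f y'}) (fun v hv => (hf v hv).le)
      (isClosed_le f.continuous continuous_const) h1
  have hly : l y = l c + f y' := by rw [← hlf, hyc, map_sub]; ring
  refine ⟨l, fun x hx => ?_, ?_⟩
  · obtain ⟨v, hv, hvx⟩ := hlift x hx
    have := hle v hv
    have h2 : l x = l c + f v := by rw [← hlf, hvx, map_sub]; ring
    rw [hly, h2]; gcongr
  · obtain ⟨v, hv⟩ := hint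
    refine ⟨c + v, interior_subset (s := F') hv, ?_⟩
    have := hf v hv
    rw [map_add, hlf, hly]
    exact fun h => this.ne (add_left_cancel h)

end Facets

theorem exists_facet {d : ℕ} {W : Finset (Euc d)} {F : Set (Euc d)} {k : ℕ}
    (hF : IsFaceOfDim (convexHull ℝ (W : Set (Euc d))) (k + 1) F) {c y : Euc d}
    (hc : c ∈ F) (hy : y ∈ F) (hout : ∀ s : ℝ, 1 < s → c + s • (y - c) ∉ F) :
    ∃ G, IsFaceOfDim (convexHull ℝ (W : Set (Euc d))) k G ∧ G ⊆ F ∧ y ∈ G := by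
  have hconv := hF.2.1.convex (convex_convexHull ℝ _)
  have heq := IsExposed.eq_convexHull_inter hF.2.1
  obtain ⟨l, hl⟩ := exists_supportsAt hconv hc hy hout
  have h1 := @exists_facet_of_supportsAt _ _ _ _ ((W : Set (Euc d)) ∩ F)
    (W.finite_toSet.inter_of_left F) y
  rw [← heq] at h1
  obtain ⟨l', hl', hk⟩ := h1 hy hF.2.2 hl
  exact ⟨faceAt F y l', ⟨⟨y, hy, rfl⟩,
    IsExposed.trans_of_convexHull hF.2.1 (isExposed_faceAt hy hl'), hk⟩, fun x hx => hx.1, hy, rfl⟩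


/-! ### Covering the polytope by flag simplices. -/

theorem exists_last_point {d : ℕ} {F : Set (Euc d)} (hF : IsCompact F) {c x : Euc d}
    (hx : x ∈ F) (hne : x ≠ c) :
    ∃ s : ℝ, 1 ≤ s ∧ c + s • (x - c) ∈ F ∧ ∀ t, s < t → c + t • (x - c) ∉ F := by
  obtain ⟨R, hR⟩ := hF.isBounded.exists_norm_le
  have hpos : 0 < ‖x - c‖ := norm_pos_iff.2 (sub_ne_zero.2 hne)
  have hB : ∀ t : ℝ, 1 ≤ t → c + t • (x - c) ∈ F → t ≤ (R + ‖c‖) / ‖x - c‖ := by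
    intro t ht htF
    rw [le_div_iff₀ hpos]
    calc t * ‖x - c‖ = ‖t • (x - c)‖ := by
          rw [norm_smul, Real.norm_of_nonneg (by linarith)]
      _ = ‖(c + t • (x - c)) - c‖ := by rw [add_sub_cancel_left]
      _ ≤ ‖c + t • (x - c)‖ + ‖c‖ := norm_sub_le _ _
      _ ≤ R + ‖c‖ := by gcongr; exact hR _ htF
  have h1 : c + (1 : ℝ) • (x - c) ∈ F := by simpa using hx
  obtain ⟨s, hs, hmax⟩ := (isCompact_Icc.inter_right (hF.isClosed.preimage
      (by fun_prop : Continuous fun t : ℝ => c + t • (x - c)))).exists_isMaxOn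
    (s := Icc 1 ((R + ‖c‖) / ‖x - c‖) ∩ (fun t : ℝ => c + t • (x - c)) ⁻¹' F)
    ⟨1, ⟨le_rfl, hB 1 le_rfl h1⟩, h1⟩ (f := fun t => t) continuous_id.continuousOn
  refine ⟨s, hs.1.1, hs.2, fun t ht htF => ?_⟩
  have h2 : (1 : ℝ) ≤ t := hs.1.1.trans ht.le
  exact absurd (hmax ⟨⟨h2, hB t h2 htF⟩, htF⟩) (not_le.2 ht)

theorem exists_boundary_point {d : ℕ} {F : Set (Euc d)} (hF : IsCompact F) {c x : Euc d}
    (hx : x ∈ F) (hdim : Module.finrank ℝ (vectorSpan ℝ F) ≠ 0) :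
    ∃ y ∈ F, (∀ s : ℝ, 1 < s → c + s • (y - c) ∉ F) ∧
      ∃ θ : ℝ, 0 ≤ θ ∧ θ ≤ 1 ∧ x = θ • y + (1 - θ) • c := by
  have key : ∀ x₀ ∈ F, x₀ ≠ c → ∃ s : ℝ, 1 ≤ s ∧ c + s • (x₀ - c) ∈ F ∧
      ∀ r : ℝ, 1 < r → c + r • (c + s • (x₀ - c) - c) ∉ F := by
    intro x₀ hx₀ hne
    obtain ⟨s, hs, hsF, hout⟩ := exists_last_point hF hx₀ hne
    refine ⟨s, hs, hsF, fun r hr => ?_⟩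
    rw [add_sub_cancel_left, smul_smul]
    exact hout _ (by nlinarith)
  -- When `x = c` any ray from `c` serves, with `θ = 0`.
  by_cases hxc : x = c
  · obtain ⟨x₀, hx₀, hne⟩ : ∃ x₀ ∈ F, x₀ ≠ c := by
      by_contra! hcon
      refine hdim ?_
      rw [vectorSpan_of_subsingleton ℝ (fun a ha b hb => (hcon a ha).trans (hcon b hb).symm),
        finrank_bot]
    obtain ⟨s, -, hsF, hout⟩ := key x₀ hx₀ hne
    exact ⟨_, hsF, hout, 0, le_rfl, zero_le_one, by simp [hxc]⟩
  · obtain ⟨s, hs, hsF, hout⟩ := key x hx hxc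
    have hs0 : 0 < s := by linarith
    refine ⟨_, hsF, hout, s⁻¹, by positivity, inv_le_one_of_one_le₀ hs, ?_⟩
    match_scalars <;> (field_simp; try ring)

/-- The ray from `c F` through `x` leaves `F` at a point `y` of some facet of `F`. Induction writes
`y` as a convex combination over a chain in that facet, and `x` lies between `y` and `c F`. -/
theorem exists_chain {d : ℕ} {W : Finset (Euc d)} (c : Set (Euc d) → Euc d)
    (hc : ∀ F, F.Nonempty → IsExposed ℝ (convexHull ℝ (W : Set (Euc d))) F → c F ∈ F) (k : ℕ)
    (F : Set (Euc d)) (hF : IsFaceOfDim (convexHull ℝ (W : Set (Euc d))) k F) (x : Euc d)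
    (hx : x ∈ F) :
    ∃ G : ℕ → Set (Euc d), (∀ i ≤ k, IsFaceOfDim (convexHull ℝ (W : Set (Euc d))) i (G i)) ∧
      (∀ i j, i ≤ j → j ≤ k → G i ⊆ G j) ∧ G k = F ∧
      ∃ l : ℕ → ℝ, (∀ i, 0 ≤ l i) ∧ ∑ i ∈ Finset.range (k + 1), l i = 1 ∧
        x = ∑ i ∈ Finset.range (k + 1), l i • c (G i) := by
  induction k generalizing F x with
  | zero =>
    have h0 : x = c F := by
      have h1 := vsub_mem_vectorSpan ℝ hx (hc F hF.1 hF.2.1)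
      rw [Submodule.finrank_eq_zero.1 hF.2.2, Submodule.mem_bot, vsub_eq_sub, sub_eq_zero] at h1
      exact h1
    refine ⟨fun _ => F, fun i hi => ?_, fun _ _ _ _ => Subset.rfl, rfl, fun _ => 1,
      fun _ => zero_le_one, by simp, by simpa using h0⟩
    obtain rfl : i = 0 := by omega
    exact hF
  | succ k ih =>
    have hPc : IsCompact (convexHull ℝ (W : Set (Euc d))) := W.finite_toSet.isCompact_convexHull ℝ
    obtain ⟨y, hy, hout, θ, hθ0, hθ1, hxy⟩ := exists_boundary_point (c := c F)
      (hF.2.1.isCompact hPc) hx (by rw [hF.2.2]; omega)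
    obtain ⟨F', hF', hFF', hyF'⟩ := exists_facet hF (hc F hF.1 hF.2.1) hy hout
    obtain ⟨G, hG, hmono, hGk, l, hl, hl1, hyl⟩ := ih F' hF' y hyF'
    have hne : ∀ i ∈ Finset.range (k + 1), i ≠ k + 1 := fun i hi => by
      rw [Finset.mem_range] at hi; omega
    refine ⟨fun i => if i = k + 1 then F else G i, fun i hi => ?_, fun i j hij hj => ?_, by simp,
      fun i => if i = k + 1 then 1 - θ else θ * l i, fun i => ?_, ?_, ?_⟩
    · by_cases h : i = k + 1
      · simpa [h] using hF
      · simpa [h] using hG i (by omega)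
    · by_cases h : j = k + 1
      · by_cases h' : i = k + 1
        · simp [h, h']
        · simp only [h, h', if_true, if_false]
          exact (hmono i k (by omega) le_rfl).trans (hGk ▸ hFF')
      · have h' : i ≠ k + 1 := by omega
        simpa [h, h'] using hmono i j hij (by omega)
    · have := hl i
      have : 0 ≤ 1 - θ := by linarith
      dsimp only
      split_ifs <;> positivity
    · rw [Finset.sum_range_succ, if_pos rfl,
        Finset.sum_congr rfl fun i hi => if_neg (hne i hi), ← Finset.mul_sum, hl1]
      ring
    · dsimp only
      rw [Finset.sum_range_succ, if_pos rfl, if_pos rfl,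
        Finset.sum_congr rfl fun i hi => by rw [if_neg (hne i hi), if_neg (hne i hi), mul_smul],
        ← Finset.smul_sum, ← hyl]
      exact hxy

/-- A face is determined by the generators it contains. Finiteness matters because `ncard` of an
infinite set is 0. -/
theorem finite_flags {d : ℕ} (W : Finset (Euc d)) :
    {F : Fin d → Set (Euc d) | IsFlag (convexHull ℝ (W : Set (Euc d))) F}.Finite := by
  have h : {F : Set (Euc d) | IsExposed ℝ (convexHull ℝ (W : Set (Euc d))) F}.Finite := by
    refine Set.Finite.of_injOn (f := fun F => (W : Set (Euc d)) ∩ F)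
      (t := 𝒫 (W : Set (Euc d))) (fun F _ => inter_subset_left) ?_ W.finite_toSet.finite_subsets
    intro F hF G hG hFG
    rw [IsExposed.eq_convexHull_inter hF, IsExposed.eq_convexHull_inter hG]
    exact congrArg _ hFG
  exact (Set.Finite.pi' fun _ : Fin d => h).subset fun F hF i => (hF.1 i).2.1

theorem isFaceOfDim_self {d : ℕ} {P : Set (Euc d)} (hP : volume P ≠ 0) : IsFaceOfDim P d P := by
  have hne : P.Nonempty := nonempty_of_measure_ne_zero hP
  refine ⟨hne, IsExposed.refl P, ?_⟩
  have htop : affineSpan ℝ P = ⊤ := by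
    by_contra h
    exact hP (measure_mono_null (subset_affineSpan ℝ P) (Measure.addHaar_affineSubspace _ _ h))
  rw [(AffineSubspace.affineSpan_eq_top_iff_vectorSpan_eq_top_of_nonempty ℝ _ _ hne).1 htop,
    finrank_top, finrank_euclideanSpace, Fintype.card_fin]

/-- A flag of `P` completed by `P` itself. -/
def completeFlag {d : ℕ} (P : Set (Euc d)) (f : Fin d → Set (Euc d)) (i : ℕ) : Set (Euc d) :=
  if h : i < d then f ⟨i, h⟩ else P

/-- The points of the simplex of a flag whose midpoint with `z` has cap volume below `T`. -/
def flagRegion {n : ℕ} (P : Set (Euc (n + 1))) (c : Set (Euc (n + 1)) → Euc (n + 1))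
    (z : Euc (n + 1)) (T : ℝ) (f : Fin (n + 1) → Set (Euc (n + 1))) : Set (Euc (n + 1)) :=
  {x | (∃ l : Euc (n + 1), (∀ i, 0 ≤ l i) ∧ ∑ i, l i ≤ 1 ∧
    x = c (f 0) + ∑ i, l i • (c (completeFlag P f (i + 1)) - c (f 0))) ∧
    capVol P ((1 / 2 : ℝ) • (x + z)) < T}

theorem capVol_midpoint_lt_of_mem_visibleSet {d : ℕ} {P : Set (Euc d)} (hP : Convex ℝ P)
    {x z : Euc d} {T : ℝ} (hz : z ∈ P) (hx : x ∈ visibleSet P z T) :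
    capVol P ((1 / 2 : ℝ) • (x + z)) < T := by
  have hseg : (1 / 2 : ℝ) • (x + z) ∈ segment ℝ x z :=
    ⟨1 / 2, 1 / 2, by norm_num, by norm_num, by norm_num, (smul_add _ _ _).symm⟩
  by_contra hcon
  have : (1 / 2 : ℝ) • (x + z) ∈ segment ℝ x z ∩ floatingBody P T :=
    ⟨hseg, hP.segment_subset hx.1 hz hseg, not_lt.1 hcon⟩
  rw [hx.2] at this
  exact this

theorem visibleSet_subset_iUnion_flagRegion {n : ℕ} {W : Finset (Euc (n + 1))}
    {P : Set (Euc (n + 1))} (hPW : P = convexHull ℝ (W : Set (Euc (n + 1)))) (hP : volume P ≠ 0)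
    (c : Set (Euc (n + 1)) → Euc (n + 1)) (hc : ∀ F, F.Nonempty → IsExposed ℝ P F → c F ∈ F)
    {z : Euc (n + 1)} (hz : z ∈ P) (T : ℝ) :
    visibleSet P z T ⊆ ⋃ f ∈ {f | IsFlag P f}, flagRegion P c z T f := by
  intro x hx
  subst hPW
  obtain ⟨G, hG, hmono, hGk, l, hl, hl1, hxl⟩ :=
    exists_chain c hc (n + 1) _ (isFaceOfDim_self hP) x hx.1
  set f : Fin (n + 1) → Set (Euc (n + 1)) := fun i => G i with hf
  have hflag : IsFlag (convexHull ℝ (W : Set (Euc (n + 1)))) f :=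
    ⟨fun i => hG i (by omega), fun i j hij => hmono i j hij (by omega)⟩
  refine mem_iUnion₂.2 ⟨f, hflag, ⟨WithLp.toLp 2 fun i => l (i + 1), fun i => hl _, ?_, ?_⟩,
    capVol_midpoint_lt_of_mem_visibleSet (convex_convexHull ℝ _) hz hx⟩
  · rw [Finset.sum_range_succ', Finset.sum_range] at hl1
    have := hl 0
    simp only
    linarith
  · have hcf : ∀ i : Fin (n + 1), completeFlag (convexHull ℝ (W : Set (Euc (n + 1)))) f (i + 1) =
        G (i + 1) := by
      intro i
      unfold completeFlag
      split_ifs with h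
      · rfl
      · have : (i : ℕ) + 1 = n + 1 := by omega
        rw [this, hGk]
    have hl0 : l 0 = 1 - ∑ i : Fin (n + 1), l (i + 1) := by
      rw [Finset.sum_range_succ', Finset.sum_range] at hl1
      linarith
    rw [hxl, Finset.sum_range_succ', Finset.sum_range, hl0]
    simp only [hcf, smul_sub, Finset.sum_sub_distrib, ← Finset.sum_smul, sub_smul, one_smul]
    have : f 0 = G 0 := rfl
    rw [this]
    abel

theorem exists_flag {d : ℕ} {W : Finset (Euc d)}
    (hP : volume (convexHull ℝ (W : Set (Euc d))) ≠ 0) :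
    ∃ f, IsFlag (convexHull ℝ (W : Set (Euc d))) f := by
  classical
  obtain ⟨z, hz⟩ := nonempty_of_measure_ne_zero hP
  obtain ⟨G, hG, hmono, -⟩ := exists_chain
    (fun F => if h : F.Nonempty then h.some else 0)
    (fun F hF _ => by rw [dif_pos hF]; exact hF.some_mem) d _ (isFaceOfDim_self hP) z hz
  exact ⟨fun i => G i, fun i => hG i i.2.le, fun i j hij => hmono i j hij j.2.le⟩

theorem volume_flagRegion_le {n : ℕ} {P : Set (Euc (n + 1))} (hP : Convex ℝ P)
    (hPc : IsCompact P) (hP0 : volume P ≠ 0) (c : Set (Euc (n + 1)) → Euc (n + 1))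
    (hc : ∀ F, F.Nonempty → IsExposed ℝ P F →
      c F ∈ F ∧ ∀ y ∈ F, c F + (1 / ((n + 1 : ℕ) : ℝ)) • (c F - y) ∈ F)
    {z : Euc (n + 1)} {T : ℝ} (hz : 0 < capVol P z) (hT : 2 * capVol P z ≤ T)
    {f : Fin (n + 1) → Set (Euc (n + 1))} (hf : IsFlag P f) :
    volume (flagRegion P c z T f) ≤
      ENNReal.ofReal (simplexConst n * (T * Real.log (T / capVol P z) ^ n)) := by
  have h0 : c (f 0) ∈ f 0 := (hc _ (hf.1 0).1 (hf.1 0).2.1).1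
  refine volume_simplex_le hP hPc ((hf.1 0).2.1.subset h0) (fun i => ?_) hz hT
  have hface : (completeFlag P f (i + 1)).Nonempty ∧
      IsExposed ℝ P (completeFlag P f (i + 1)) ∧ f 0 ⊆ completeFlag P f (i + 1) := by
    unfold completeFlag
    split_ifs with h
    · exact ⟨(hf.1 _).1, (hf.1 _).2.1, hf.2 _ _ (Fin.zero_le _)⟩
    · exact ⟨nonempty_of_measure_ne_zero hP0, IsExposed.refl P, (hf.1 0).2.1.subset⟩
  have h1 := hface.2.1.subset ((hc _ hface.1 hface.2.1).2 _ (hface.2.2 h0))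
  convert! h1 using 1
  module

end PoissonPolytope

end

/-! ### Summation over the flags. -/

theorem mainTheorem3 (d : ℕ) (hd : 1 ≤ d) :
    ∃ c : ℝ, 0 < c ∧
      ∀ P : Set (PoissonPolytope.Euc d), PoissonPolytope.IsPolytope P → volume P = 1 →
        ∀ (z : PoissonPolytope.Euc d) (T : ℝ), z ∈ P →
          0 < PoissonPolytope.capVol P z → PoissonPolytope.capVol P z ≤ 1 / 2 →
          2 * PoissonPolytope.capVol P z ≤ T →
          volume.real (PoissonPolytope.visibleSet P z T) <
            c * ((PoissonPolytope.numFlags P : ℝ) * T *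
              Real.log (T / PoissonPolytope.capVol P z) ^ (d - 1)) := by
  classical
  open PoissonPolytope in
  obtain ⟨n, rfl⟩ : ∃ n, d = n + 1 := ⟨d - 1, by omega⟩
  have hC := simplexConst_pos n
  -- The added 1 gives the strict inequality, since there is at least one flag and `T * log (T /
  -- v(z)) ^ n` is positive.
  refine ⟨simplexConst n + 1, by linarith, ?_⟩
  rintro P ⟨W, hPW⟩ hP1 z T hz hz0 - hT
  have hP0 : volume P ≠ 0 := by rw [hP1]; exact one_ne_zero
  have hconv : Convex ℝ P := hPW ▸ convex_convexHull ℝ _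
  have hcomp : IsCompact P := hPW ▸ W.finite_toSet.isCompact_convexHull ℝ
  have hex : ∀ F : Set (Euc (n + 1)), ∃ c : Euc (n + 1), F.Nonempty → IsExposed ℝ P F →
      c ∈ F ∧ ∀ y ∈ F, c + (1 / ((n + 1 : ℕ) : ℝ)) • (c - y) ∈ F := by
    intro F
    by_cases h : F.Nonempty ∧ IsExposed ℝ P F
    · obtain ⟨c, hc⟩ := exists_central_point hd (h.2.convex hconv) (h.2.isCompact hcomp) h.1
      exact ⟨c, fun _ _ => hc⟩
    · exact ⟨0, fun h1 h2 => absurd ⟨h1, h2⟩ h⟩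
  choose c hc using hex
  have hfin : {f : Fin (n + 1) → Set (Euc (n + 1)) | IsFlag P f}.Finite := hPW ▸ finite_flags W
  have hcard : 1 ≤ numFlags P := by
    obtain ⟨f, hf⟩ := exists_flag (W := W) (hPW ▸ hP0)
    exact Nat.one_le_iff_ne_zero.2 (Set.ncard_ne_zero_of_mem (hPW ▸ hf) hfin)
  have hT0 : 0 < T := by linarith
  have hlog : 0 < Real.log (T / capVol P z) := by
    refine Real.log_pos ?_
    rw [one_lt_div hz0]; linarith
  set B := T * Real.log (T / capVol P z) ^ n with hB
  have hB0 : 0 < B := by positivity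
  have hvol : volume (visibleSet P z T) ≤ ENNReal.ofReal (numFlags P * (simplexConst n * B)) := by
    calc volume (visibleSet P z T)
        ≤ volume (⋃ f ∈ hfin.toFinset, flagRegion P c z T f) := by
          refine measure_mono ?_
          simpa using visibleSet_subset_iUnion_flagRegion hPW hP0 c
            (fun F h1 h2 => (hc F h1 h2).1) hz T
      _ ≤ ∑ f ∈ hfin.toFinset, volume (flagRegion P c z T f) := measure_biUnion_finset_le _ _
      _ ≤ ∑ f ∈ hfin.toFinset, ENNReal.ofReal (simplexConst n * B) := by
          refine Finset.sum_le_sum fun f hf => ?_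
          exact volume_flagRegion_le hconv hcomp hP0 c hc hz0 hT (hfin.mem_toFinset.1 hf)
      _ = ENNReal.ofReal (numFlags P * (simplexConst n * B)) := by
          rw [Finset.sum_const, nsmul_eq_mul, ENNReal.ofReal_mul (p := (numFlags P : ℝ)) (by positivity),
            ENNReal.ofReal_natCast, numFlags, Set.ncard_eq_toFinset_card _ hfin]
  have hN : (1 : ℝ) ≤ numFlags P := by exact_mod_cast hcard
  calc volume.real (visibleSet P z T) ≤ numFlags P * (simplexConst n * B) :=
        ENNReal.toReal_le_of_le_ofReal (by positivity) hvol
    _ < (simplexConst n + 1) * (numFlags P * B) := by nlinarith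
    _ = _ := by rw [hB, Nat.add_sub_cancel]; ring
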